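/- For every integer $d\ge 1$ there is a quantum channel $\mathcal E$ whose input space is $\mathcal B(\mathcal H_2\otimes\mathcal H_d)=\mathcal B(\mathcal H_{2d})$ (and whose output space is finite-dimensional) such that $C^{(0)}(\mathcal E)=0$ and, with $\mathcal I_2$ the noiseless qubit channel: 1. $C^{(0)}(\mathcal I_2\otimes\mathcal E)\ge\log_2 d$, while $C^{(0)}(\mathcal I_2)+C^{(0)}(\mathcal E)=1$; in particular $C^{(0)}(\mathcal I_2\otimes\mathcal E)>C^{(0)}(\mathcal I_2)+C^{(0)}(\mathcal E)$ if $d>2$. 2. $Q^{(0)}(\mathcal I_2\otimes\mathcal E)\ge\log_2 d$, while $Q^{(0)}(\mathcal I_2)+Q^{(0)}(\mathcal E)=1$; in particular $Q^{(0)}(\mathcal I_2\otimes\mathcal E)>Q^{(0)}(\mathcal I_2)+Q^{(0)}(\mathcal E)$ if $d>2$. 3. $C^{(0)}_2(\mathcal E)\ge Q^{(0)}_2(\mathcal E)\ge\log_2 d$. 4. $C^{(0)}_{1\,\mathrm{ebit}}(\mathcal E)\ge Q^{(0)}_{1\,\mathrm{ebit}}(\mathcal E)\ge\log_2 d$. Here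 $C^{(0)}(\mathcal E)=\sup_{k\ge1}\frac1k\log_2\alpha(\mathcal E^{\otimes k})$, where $\alpha(\mathcal F)$ is the largest number of input states whose images under $\mathcal F$ are perfectly distinguishable by a measurement, and $Q^{(0)}(\mathcal E)=\sup_{k\ge1}\frac1k\log_2\alpha^q(\mathcal E^{\otimes k})$, where $\alpha^q(\mathcal F)$ is the largest dimension of a subspace of the input space all of whose states can be recovered perfectly by some channel applied after $\mathcal F$. In $C^{(0)}_{1\,\mathrm{ebit}}$ and $Q^{(0)}_{1\,\mathrm{ebit}}$ the quantities $\alpha(\mathcal E^{\otimes k})$ and $\alpha^q(\mathcal E^{\otimes k})$ are replaced by the largest number of messages, respectively the largest dimension of a quantum system, that can be transmitted without error by one use of $\mathcal E^{\otimes k}$ when sender and receiver share, in addition, one two-qubit state $(|00\rangle+|11\rangle)/\sqrt2$ and apply arbitrary local channels for encoding and decoding. In $C^{(0)}_2$ and $Q^{(0)}_2$ they are replaced by the largest number of messages, respectively the largest dimension of a quantum system, that can be transmitted without error by protocols with $k$ successive uses of $\mathcal E$ and free two-way classical communication that is independent of the message. Independence means that whatever the sender announces is obtained by measuring an auxiliary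 system of hers that never interacts with the message, and that the probability of every transcript of the classical communication is the same for all messages (respectively, for all states of the transmitted system). -/

import Mathlib

open scoped Kronecker ComplexOrder

namespace ZeroError

noncomputable section

/-! ### States, completely positive maps, channels and measurements -/

/-- Linear maps from the operators on the Hilbert space `ℂ^a` to the operators on `ℂ^b`. -/
abbrev SuperOp (a b : Type) : Type := Matrix a a ℂ →ₗ[ℂ] Matrix b b ℂ

/-- Density operators. -/
def IsState {a : Type} [Fintype a] (ρ : Matrix a a ℂ) : Prop :=
  ρ.PosSemidef ∧ ρ.trace = 1

/-- The operator `|ψ⟩⟨ψ|`. -/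
def pureState {a : Type} (ψ : a → ℂ) : Matrix a a ℂ := Matrix.vecMulVec ψ (star ψ)

/-- Complete positivity, through a finite family of Kraus operators. -/
def IsCP {a b : Type} [Fintype a] (Φ : SuperOp a b) : Prop :=
  ∃ (κ : ℕ) (K : Fin κ → Matrix b a ℂ), ∀ X, Φ X = ∑ k, K k * X * (K k).conjTranspose

/-- Quantum channels: completely positive trace-preserving maps. -/
def IsChannel {a b : Type} [Fintype a] [Fintype b] (Φ : SuperOp a b) : Prop :=
  IsCP Φ ∧ ∀ X, (Φ X).trace = X.trace

/-- Quantum instruments with outcomes in `X`: completely positive maps (one for each outcome)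
whose sum is trace preserving. -/
def IsInstrument {a b X : Type} [Fintype a] [Fintype b] [Fintype X] (J : X → SuperOp a b) : Prop :=
  (∀ x, IsCP (J x)) ∧ ∀ Y, ∑ x, (J x Y).trace = Y.trace

/-- Some measurement (POVM) identifies without error which of the (possibly unnormalized) states
`σ i` is present: outcome `j` has probability zero on `σ i` whenever `i ≠ j`. -/
def PerfectlyDistinguishable {N : ℕ} {b : Type} [Fintype b] [DecidableEq b]
    (σ : Fin N → Matrix b b ℂ) : Prop :=
  ∃ M : Fin N → Matrix b b ℂ, (∀ j, (M j).PosSemidef) ∧ ∑ j, M j = 1 ∧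
    ∀ i j, i ≠ j → (M j * σ i).trace = 0

/-! ### Tensor products -/

/-- The tensor product `Φ ⊗ Ψ` of two linear maps: `Ψ` is applied to the second factor and `Φ`
to the first one, so that `(Φ ⊗ Ψ)(X ⊗ Y) = Φ X ⊗ Ψ Y`. -/
def tensorMap {a b c e : Type} (Φ : SuperOp a b) (Ψ : SuperOp c e) : SuperOp (a × c) (b × e) where
  toFun X := Matrix.of fun p q =>
    Φ (Matrix.of fun i j => Ψ (Matrix.of fun k l => X (i, k) (j, l)) p.2 q.2) p.1 q.1
  map_add' X Y := by
    ext p q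
    have h : (Matrix.of fun i j => Ψ (Matrix.of fun k l => (X + Y) (i, k) (j, l)) p.2 q.2 :
        Matrix a a ℂ) = (Matrix.of fun i j => Ψ (Matrix.of fun k l => X (i, k) (j, l)) p.2 q.2)
          + Matrix.of fun i j => Ψ (Matrix.of fun k l => Y (i, k) (j, l)) p.2 q.2 := by
      ext i j
      exact congrFun (congrFun (map_add Ψ (Matrix.of fun k l => X (i, k) (j, l))
        (Matrix.of fun k l => Y (i, k) (j, l))) p.2) q.2
    exact (congrArg (fun Z => Φ Z p.1 q.1) h).trans (congrFun (congrFun (map_add Φ _ _) p.1) q.1)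
  map_smul' r X := by
    ext p q
    have h : (Matrix.of fun i j => Ψ (Matrix.of fun k l => (r • X) (i, k) (j, l)) p.2 q.2 :
        Matrix a a ℂ)
          = r • (Matrix.of fun i j => Ψ (Matrix.of fun k l => X (i, k) (j, l)) p.2 q.2) := by
      ext i j
      exact congrFun (congrFun (map_smul Ψ r (Matrix.of fun k l => X (i, k) (j, l))) p.2) q.2
    exact (congrArg (fun Z => Φ Z p.1 q.1) h).trans (congrFun (congrFun (map_smul Φ r _) p.1) q.1)

/-- The tensor power `Φ^{⊗ n}`, given by its values `⊗ₜ Φ(|iₜ⟩⟨jₜ|)` on the matrix units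
`⊗ₜ |iₜ⟩⟨jₜ|`; the space `(ℂ^a)^{⊗ n}` has the index set `Fin n → a`. -/
def tensorPow {a b : Type} [Fintype a] [DecidableEq a] (Φ : SuperOp a b) (n : ℕ) :
    SuperOp (Fin n → a) (Fin n → b) where
  toFun X := Matrix.of fun f g =>
    ∑ i : Fin n → a, ∑ j : Fin n → a, X i j * ∏ t, Φ (Matrix.single (i t) (j t) 1) (f t) (g t)
  map_add' X Y := by
    ext f g
    simp only [Matrix.of_apply, Matrix.add_apply, add_mul, Finset.sum_add_distrib]
  map_smul' r X := by
    ext f g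
    simp only [Matrix.of_apply, Matrix.smul_apply, smul_eq_mul, Finset.mul_sum, mul_assoc,
      RingHom.id_apply]

/-- The noiseless qubit channel. -/
def idQubit : SuperOp (Fin 2) (Fin 2) := LinearMap.id

/-! ### Rates -/

/-- The base-two logarithm of an extended natural number. -/
def log2 : ℕ∞ → EReal
  | ⊤ => ⊤
  | (n : ℕ) => ((Real.logb 2 n : ℝ) : EReal)

/-- `sup_{k ≥ 1} log₂ (α k) / k`. -/
def rate (α : ℕ → ℕ∞) : EReal :=
  ⨆ (k : ℕ) (_ : 1 ≤ k), log2 (α k) / ((k : ℝ) : EReal)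

section Unassisted

variable {a b : Type} [Fintype a] [DecidableEq a] [Fintype b] [DecidableEq b]

/-- `α(Φ)`: the largest number of states that remain perfectly distinguishable after one use of
`Φ`. -/
def cliqueNumber (Φ : SuperOp a b) : ℕ∞ :=
  ⨆ (N : ℕ) (_ : ∃ ρ : Fin N → Matrix a a ℂ,
    (∀ i, IsState (ρ i)) ∧ PerfectlyDistinguishable fun i => Φ (ρ i)), (N : ℕ∞)

/-- The zero-error classical capacity `C⁽⁰⁾(Φ)`. -/
def zeroErrorC (Φ : SuperOp a b) : EReal := rate fun k => cliqueNumber (tensorPow Φ k)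

/-- `α^q(Φ)`: the largest dimension of a subspace of the input space (the range of an isometry
`V`) whose states are recovered perfectly by some channel after one use of `Φ`. -/
def quantumCliqueDim (Φ : SuperOp a b) : ℕ∞ :=
  ⨆ (N : ℕ) (_ : ∃ (V : Matrix a (Fin N) ℂ) (D : SuperOp b (Fin N)),
    V.conjTranspose * V = 1 ∧ IsChannel D ∧
    ∀ ψ : Fin N → ℂ, D (Φ (V * pureState ψ * V.conjTranspose)) = pureState ψ), (N : ℕ∞)

/-- The zero-error quantum capacity `Q⁽⁰⁾(Φ)`. -/
def zeroErrorQ (Φ : SuperOp a b) : EReal := rate fun k => quantumCliqueDim (tensorPow Φ k)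

end Unassisted

/-! ### Assistance by one ebit -/

/-- The maximally entangled two-qubit state `|Φ₂⟩⟨Φ₂|`, `|Φ₂⟩ = (|00⟩ + |11⟩)/√2`. -/
def bell : Matrix (Fin 2 × Fin 2) (Fin 2 × Fin 2) ℂ :=
  Matrix.of fun p q => if p.1 = p.2 ∧ q.1 = q.2 then 1 / 2 else 0

section Ebit

variable {a b : Type} [Fintype a] [DecidableEq a] [Fintype b] [DecidableEq b]

/-- The largest number of classical messages that one use of `Φ` and one ebit transmit without
error. Bob holds the first qubit of `bell`, Alice the second one; to send message `i` she applies
the channel `enc i` to her qubit and puts the result into `Φ`. -/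
def cliqueNumberEbit (Φ : SuperOp a b) : ℕ∞ :=
  ⨆ (N : ℕ) (_ : ∃ enc : Fin N → SuperOp (Fin 2) a, (∀ i, IsChannel (enc i)) ∧
    PerfectlyDistinguishable fun i => tensorMap (LinearMap.id : SuperOp (Fin 2) (Fin 2))
      (Φ ∘ₗ enc i) bell), (N : ℕ∞)

/-- The zero-error classical capacity when one ebit (in all) is available. -/
def zeroErrorCEbit (Φ : SuperOp a b) : EReal := rate fun k => cliqueNumberEbit (tensorPow Φ k)

/-- The largest dimension of a quantum system that one use of `Φ` and one ebit transmit without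
error. Alice applies the channel `enc` to her half of `bell` and the system to be sent; Bob
applies `D` to his half of `bell` and the output of `Φ`. -/
def quantumCliqueDimEbit (Φ : SuperOp a b) : ℕ∞ :=
  ⨆ (N : ℕ) (_ : ∃ (enc : SuperOp (Fin 2 × Fin N) a) (D : SuperOp (Fin 2 × b) (Fin N)),
    IsChannel enc ∧ IsChannel D ∧
    ∀ ψ : Fin N → ℂ,
      D (tensorMap (LinearMap.id : SuperOp (Fin 2) (Fin 2)) (Φ ∘ₗ enc)
        ((bell ⊗ₖ pureState ψ).submatrix
          (Equiv.prodAssoc (Fin 2) (Fin 2) (Fin N)).symm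
          (Equiv.prodAssoc (Fin 2) (Fin 2) (Fin N)).symm)) = pureState ψ), (N : ℕ∞)

/-- The zero-error quantum capacity when one ebit (in all) is available. -/
def zeroErrorQEbit (Φ : SuperOp a b) : EReal := rate fun k => quantumCliqueDimEbit (tensorPow Φ k)

end Ebit

/-! ### Assistance by two-way classical communication that is independent of the message -/

/-- A stage of a protocol that sends the state of an `N`-dimensional message system.
`T` is the set of possible transcripts of the classical communication so far. Alice holds a system
`M`, which carries the message, and a system `R`, which never interacts with the message; Bob holds
`S`. `branch t ρ` is the unnormalized joint state after the transcript `t` when the message is `ρ`;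
its trace is the probability of `t`. -/
structure Stage (N : ℕ) where
  T : Type
  M : Type
  R : Type
  S : Type
  [fintypeT : Fintype T]
  [fintypeM : Fintype M]
  [fintypeR : Fintype R]
  [fintypeS : Fintype S]
  [decEqS : DecidableEq S]
  branch : T → Matrix (Fin N) (Fin N) ℂ → Matrix (M × R × S) (M × R × S) ℂ

attribute [instance] Stage.fintypeT Stage.fintypeM Stage.fintypeR Stage.fintypeS Stage.decEqS

/-- Bob's reduced state. -/
def bobState {M R S : Type} [Fintype M] [Fintype R] (X : Matrix (M × R × S) (M × R × S) ℂ) :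
    Matrix S S ℂ :=
  Matrix.of fun s s' => ∑ m, ∑ r, X (m, r, s) (m, r, s')

/-- `Reachable E n P`: the stage `P` can be reached by a protocol with `n` uses of the channel `E`
and free two-way classical communication. All classical communication from Alice to Bob is produced
from the system `R`; the message system only enters the preparation of the channel inputs. All
operations may depend on the transcript. -/
inductive Reachable {a b : Type} [Fintype a] [Fintype b] [DecidableEq b] (E : SuperOp a b) {N : ℕ} :
    ℕ → Stage N → Prop
  /-- Alice holds the message and, independently of it, a system `R` in the state `σ`; Bob holds a
  trivial system. -/
  | init {R : Type} [Fintype R] (σ : Matrix R R ℂ) (hσ : IsState σ) :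
      Reachable E 0
        { T := Unit, M := Fin N, R := R, S := Unit
          branch := fun _ ρ => ρ ⊗ₖ (σ ⊗ₖ (1 : Matrix Unit Unit ℂ)) }
  /-- Alice applies an instrument to `R` and announces its outcome. -/
  | alice {n : ℕ} {P : Stage N} (hP : Reachable E n P) {R' X : Type} [Fintype R'] [Fintype X]
      (J : P.T → X → SuperOp P.R R') (hJ : ∀ t, IsInstrument (J t)) :
      Reachable E n
        { T := P.T × X, M := P.M, R := R', S := P.S
          branch := fun t ρ =>
            tensorMap LinearMap.id (tensorMap (J t.1 t.2) LinearMap.id) (P.branch t.1 ρ) }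
  /-- Bob applies an instrument to his system and announces its outcome. -/
  | bob {n : ℕ} {P : Stage N} (hP : Reachable E n P) {S' X : Type} [Fintype S'] [DecidableEq S']
      [Fintype X] (J : P.T → X → SuperOp P.S S') (hJ : ∀ t, IsInstrument (J t)) :
      Reachable E n
        { T := P.T × X, M := P.M, R := P.R, S := S'
          branch := fun t ρ =>
            tensorMap LinearMap.id (tensorMap LinearMap.id (J t.1 t.2)) (P.branch t.1 ρ) }
  /-- Alice splits `R` into `R'` and `Q`, applies a channel to `M` and `Q` which produces a new
  message-carrying system `M'` and an input for `E`, and sends this input to Bob through `E`. -/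
  | use {n : ℕ} {P : Stage N} (hP : Reachable E n P) {M' R' Q : Type} [Fintype M'] [Fintype R']
      [Fintype Q] (e : P.R ≃ R' × Q)
      (W : P.T → SuperOp (P.M × Q) (M' × a)) (hW : ∀ t, IsChannel (W t)) :
      Reachable E (n + 1)
        { T := P.T, M := M', R := R', S := P.S × b
          branch := fun t ρ =>
            (tensorMap (tensorMap (LinearMap.id : SuperOp M' M') E ∘ₗ W t)
                (LinearMap.id : SuperOp (R' × P.S) (R' × P.S))
              ((P.branch t ρ).submatrix
                (fun x : (P.M × Q) × (R' × P.S) => (x.1.1, e.symm (x.2.1, x.1.2), x.2.2))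
                (fun x : (P.M × Q) × (R' × P.S) => (x.1.1, e.symm (x.2.1, x.1.2), x.2.2)))).submatrix
              (fun y : M' × R' × P.S × b => ((y.1, y.2.2.2), (y.2.1, y.2.2.1)))
              (fun y : M' × R' × P.S × b => ((y.1, y.2.2.2), (y.2.1, y.2.2.1))) }

section TwoWay

variable {a b : Type} [Fintype a] [Fintype b] [DecidableEq b]

/-- The largest number of classical messages that `n` uses of `E` transmit without error with the
help of two-way classical communication that is independent of the message: the probability of each
transcript is the same for all messages, and given the transcript Bob can perfectly distinguish the
messages. -/
def cliqueNumberTwoWay (E : SuperOp a b) (n : ℕ) : ℕ∞ :=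
  ⨆ (N : ℕ) (_ : ∃ P : Stage N, Reachable E n P ∧
    (∀ (t : P.T) (i j : Fin N), (P.branch t (Matrix.single i i 1)).trace
      = (P.branch t (Matrix.single j j 1)).trace) ∧
    ∀ t : P.T, PerfectlyDistinguishable fun i : Fin N =>
      bobState (P.branch t (Matrix.single i i 1))), (N : ℕ∞)

/-- The zero-error classical capacity assisted by two-way classical communication that is
independent of the message. -/
def zeroErrorCTwoWay (E : SuperOp a b) : EReal := rate (cliqueNumberTwoWay E)

/-- The largest dimension of a quantum system that `n` uses of `E` transmit without error with the
help of two-way classical communication that is independent of the message: the probability of each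
transcript is the same for all states of the system, and Bob recovers the state by channels `D t`
that depend on the transcript `t`. -/
def quantumCliqueDimTwoWay (E : SuperOp a b) (n : ℕ) : ℕ∞ :=
  ⨆ (N : ℕ) (_ : ∃ (P : Stage N) (D : P.T → SuperOp P.S (Fin N)), Reachable E n P ∧
    (∀ t, IsChannel (D t)) ∧
    (∀ (t : P.T) (ρ ρ' : Matrix (Fin N) (Fin N) ℂ), IsState ρ → IsState ρ' →
      (P.branch t ρ).trace = (P.branch t ρ').trace) ∧
    ∀ ψ : Fin N → ℂ, ∑ t, D t (bobState (P.branch t (pureState ψ))) = pureState ψ), (N : ℕ∞)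

/-- The zero-error quantum capacity assisted by two-way classical communication that is
independent of the message. -/
def zeroErrorQTwoWay (E : SuperOp a b) : EReal := rate (quantumCliqueDimTwoWay E)

end TwoWay

end

end ZeroError

namespace ZeroError

open scoped Matrix

noncomputable section

set_option linter.unusedSectionVars false

/-! ### Completely positive maps in Kraus form -/

section Kraus

variable {a b c e κ ι : Type} [Fintype a] [Fintype b] [Fintype c] [Fintype e] [Fintype κ]
  [Fintype ι]

/-! The channel draws a flag at random and reveals it to the receiver. The flag names an orthonormal
basis of the qubit, the rows `u`, `v` of a rotation, and a unitary `U` on the message. The Kraus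
operator is a multiple of `⟨u| ⊗ 1 + ⟨v| ⊗ U`: a `U` controlled by the qubit, whose control is then
coherently erased. Its Gram operator is the identity plus a cross term `|u⟩⟨v| ⊗ U` and the adjoint
of that term. Averaging over a phase in `U` removes the cross terms, so the map preserves the trace.

Unassisted, nothing gets through. If two inputs stay distinguishable, then `ρ i * (Kᴴ * K) * ρ j =
0` for every Kraus operator `K` (`krausMap_orthogonal`), hence for every operator in the span of the
`Kᴴ * K`. A Fourier sum over the phases and a difference over the signs in `U` put each `|u⟩⟨v| ⊗
|m⟩⟨n|` into that span (`exists_sum_flagKraus`). Three rotations in general position ensure that one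
of these rank-one operators connects any two nonzero vectors (`exists_rot`), and products of them do
so on tensor powers (`exists_prod_contraction`). Hence at most one message survives, for any number
of uses (`cliqueNumber_tensorPow_le_one`).

If the control is half of a Bell pair, measuring the other half in the basis named by the flag
collapses the control. The message has then undergone exactly `1` or `U`, with equal probability
whatever the message is (`measure_flagChannel`), and this known unitary can be undone. The assisted
bounds differ only in the whereabouts of the other half: the receiver gets it through the noiseless
qubit or holds it from the ebit, or the sender keeps it, measures it after hearing the flag and
announces the outcome. Each bound uses the channel once, and classical bounds follow from quantum
ones by sending basis states. -/

/-- The map `X ↦ ∑ k, K k * X * (K k)ᴴ`. -/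
def krausMap (K : κ → Matrix b a ℂ) : SuperOp a b where
  toFun X := ∑ k, K k * X * (K k).conjTranspose
  map_add' X Y := by simp only [Matrix.mul_add, Matrix.add_mul, Finset.sum_add_distrib]
  map_smul' r X := by simp only [Matrix.mul_smul, Matrix.smul_mul, Finset.smul_sum,
    RingHom.id_apply]

lemma krausMap_apply (K : κ → Matrix b a ℂ) (X : Matrix a a ℂ) :
    krausMap K X = ∑ k, K k * X * (K k).conjTranspose := rfl

lemma isCP_krausMap (K : κ → Matrix b a ℂ) : IsCP (krausMap K) :=
  ⟨Fintype.card κ, K ∘ (Fintype.equivFin κ).symm, fun X =>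
    ((Fintype.equivFin κ).symm.sum_comp fun k => K k * X * (K k).conjTranspose).symm⟩

lemma IsCP.exists_krausMap {Φ : SuperOp a b} (h : IsCP Φ) :
    ∃ (n : ℕ) (K : Fin n → Matrix b a ℂ), Φ = krausMap K := by
  obtain ⟨n, K, hK⟩ := h
  exact ⟨n, K, LinearMap.ext hK⟩

lemma trace_mul_krausMap (K : κ → Matrix b a ℂ) (M : Matrix b b ℂ) (X : Matrix a a ℂ) :
    (M * krausMap K X).trace = ((∑ k, (K k).conjTranspose * M * K k) * X).trace := by
  rw [krausMap_apply, Matrix.mul_sum, Matrix.sum_mul, Matrix.trace_sum, Matrix.trace_sum]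
  refine Finset.sum_congr rfl fun k _ => ?_
  rw [← Matrix.mul_assoc, Matrix.trace_mul_comm]
  simp only [Matrix.mul_assoc]

lemma trace_krausMap [DecidableEq b] (K : κ → Matrix b a ℂ) (X : Matrix a a ℂ) :
    (krausMap K X).trace = ((∑ k, (K k).conjTranspose * K k) * X).trace := by
  simpa using trace_mul_krausMap K 1 X

lemma isChannel_krausMap [DecidableEq a] {K : κ → Matrix b a ℂ}
    (h : ∑ k, (K k).conjTranspose * K k = 1) : IsChannel (krausMap K) := by
  classical
  exact ⟨isCP_krausMap K, fun X => by rw [trace_krausMap, h, one_mul]⟩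

lemma isInstrument_krausMap [DecidableEq a] {K : ι → κ → Matrix b a ℂ}
    (h : ∑ x, ∑ k, (K x k).conjTranspose * K x k = 1) :
    IsInstrument fun x => krausMap (K x) := by
  classical
  refine ⟨fun x => isCP_krausMap _, fun X => ?_⟩
  simp only [trace_krausMap]
  rw [← Matrix.trace_sum, ← Matrix.sum_mul, h, one_mul]

/-- The Kraus operators of a trace-preserving map resolve the identity. -/
lemma sum_kraus_eq_one [DecidableEq a] {K : κ → Matrix b a ℂ}
    (h : ∀ X, (krausMap K X).trace = X.trace) : ∑ k, (K k).conjTranspose * K k = 1 := by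
  classical
  rw [Matrix.ext_iff_trace_mul_right]
  intro X
  rw [← trace_krausMap, h, one_mul]

lemma IsCP.posSemidef {Φ : SuperOp a b} (h : IsCP Φ) {X : Matrix a a ℂ} (hX : X.PosSemidef) :
    (Φ X).PosSemidef := by
  obtain ⟨n, K, hK⟩ := h
  rw [hK]
  exact Matrix.posSemidef_sum _ fun k _ => hX.mul_mul_conjTranspose_same _

lemma isCP_id : IsCP (LinearMap.id : SuperOp a a) := by
  classical
  exact ⟨1, fun _ => 1, fun X => by simp⟩

lemma IsCP.comp {Ψ : SuperOp b c} {Φ : SuperOp a b} (hΨ : IsCP Ψ) (hΦ : IsCP Φ) :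
    IsCP (Ψ ∘ₗ Φ) := by
  obtain ⟨n, K, rfl⟩ := hΦ.exists_krausMap
  obtain ⟨m, L, rfl⟩ := hΨ.exists_krausMap
  have : krausMap L ∘ₗ krausMap K = krausMap fun x : Fin m × Fin n => L x.1 * K x.2 := by
    ext1 X
    simp only [LinearMap.comp_apply, krausMap_apply, Fintype.sum_prod_type, Matrix.mul_sum,
      Matrix.sum_mul, Matrix.conjTranspose_mul, Matrix.mul_assoc]
  rw [this]
  exact isCP_krausMap _

lemma IsChannel.comp {Ψ : SuperOp b c} {Φ : SuperOp a b} (hΨ : IsChannel Ψ) (hΦ : IsChannel Φ) :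
    IsChannel (Ψ ∘ₗ Φ) :=
  ⟨hΨ.1.comp hΦ.1, fun X => by rw [LinearMap.comp_apply, hΨ.2, hΦ.2]⟩

/-- Relabelling of the basis. -/
def relabel (f : b ≃ a) : SuperOp a b where
  toFun X := X.submatrix f f
  map_add' _ _ := rfl
  map_smul' _ _ := rfl

lemma relabel_apply (f : b ≃ a) (X : Matrix a a ℂ) : relabel f X = X.submatrix f f := rfl

lemma isChannel_relabel (f : b ≃ a) : IsChannel (relabel f) := by
  classical
  refine ⟨⟨1, fun _ => (1 : Matrix a a ℂ).submatrix f id, fun X => ?_⟩, fun X => ?_⟩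
  · rw [Fin.sum_univ_one, Matrix.conjTranspose_submatrix, Matrix.conjTranspose_one,
      relabel_apply]
    ext i j
    simp [Matrix.mul_apply, Matrix.one_apply]
  · exact f.sum_comp fun i => X i i

lemma tensorMap_kronecker (Φ : SuperOp a b) (Ψ : SuperOp c e) (A : Matrix a a ℂ)
    (B : Matrix c c ℂ) : tensorMap Φ Ψ (A ⊗ₖ B) = Φ A ⊗ₖ Ψ B := by
  ext p q
  have h : (Matrix.of fun i j => Ψ (Matrix.of fun k l => (A ⊗ₖ B) (i, k) (j, l)) p.2 q.2 :
      Matrix a a ℂ) = Ψ B p.2 q.2 • A := by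
    ext i j
    have : (Matrix.of fun k l => (A ⊗ₖ B) (i, k) (j, l)) = A i j • B := rfl
    rw [Matrix.of_apply, this, map_smul, Matrix.smul_apply, Matrix.smul_apply, smul_eq_mul,
      smul_eq_mul, mul_comm]
  change Φ _ p.1 q.1 = Φ A p.1 q.1 * Ψ B p.2 q.2
  rw [h, map_smul, Matrix.smul_apply, smul_eq_mul, mul_comm]

/-- Matrix units of a product space are products of matrix units, so it suffices to compare both
sides on product operators. -/
lemma tensorMap_krausMap (K : κ → Matrix b a ℂ) (L : ι → Matrix e c ℂ) :
    tensorMap (krausMap K) (krausMap L) = krausMap fun x : κ × ι => K x.1 ⊗ₖ L x.2 := by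
  classical
  refine Matrix.ext_linearMap ℂ fun p q => LinearMap.ext_ring ?_
  have h : (Matrix.single p q 1 : Matrix (a × c) (a × c) ℂ)
      = Matrix.single p.1 q.1 1 ⊗ₖ Matrix.single p.2 q.2 1 := by
    simp [Matrix.single_kronecker_single]
  simp only [LinearMap.comp_apply, Matrix.singleLinearMap_apply]
  rw [h, tensorMap_kronecker]
  simp only [krausMap_apply, Matrix.conjTranspose_kronecker, ← Matrix.mul_kronecker_mul]
  ext i j
  simp only [Matrix.kroneckerMap_apply, Matrix.sum_apply, Finset.sum_mul_sum,
    Fintype.sum_prod_type]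

lemma IsCP.tensorMap {Φ : SuperOp a b} {Ψ : SuperOp c e} (hΦ : IsCP Φ) (hΨ : IsCP Ψ) :
    IsCP (tensorMap Φ Ψ) := by
  obtain ⟨n, K, rfl⟩ := hΦ.exists_krausMap
  obtain ⟨m, L, rfl⟩ := hΨ.exists_krausMap
  rw [tensorMap_krausMap]
  exact isCP_krausMap _

/-- The Kraus operators of a tensor power. -/
def krausPow (K : κ → Matrix b a ℂ) (n : ℕ) (f : Fin n → κ) : Matrix (Fin n → b) (Fin n → a) ℂ :=
  Matrix.of fun i j => ∏ t, K (f t) (i t) (j t)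

/-- Expanding the product over the factors of the sums over Kraus indices gives one Kraus operator
for each word of indices. -/
lemma tensorPow_krausMap [DecidableEq a] (K : κ → Matrix b a ℂ) (n : ℕ) :
    tensorPow (krausMap K) n = krausMap (krausPow K n) := by
  have hs (i j : a) (x y : b) : krausMap K (Matrix.single i j 1) x y
      = ∑ k, K k x i * star (K k y j) := by
    simp [krausMap_apply, Matrix.sum_apply, Matrix.mul_apply, Matrix.single_apply, ite_and]
  ext1 X
  ext p q
  change ∑ i : Fin n → a, ∑ j : Fin n → a,
    X i j * ∏ t, krausMap K (Matrix.single (i t) (j t) 1) (p t) (q t) = _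
  simp only [hs, Finset.prod_univ_sum, Fintype.piFinset_univ, Finset.prod_mul_distrib,
    krausMap_apply, krausPow, Matrix.sum_apply, Matrix.mul_apply, Matrix.of_apply,
    Matrix.conjTranspose_apply, star_prod, Finset.mul_sum, Finset.sum_mul]
  conv_lhs => enter [2, i]; rw [Finset.sum_comm]
  rw [Finset.sum_comm]
  refine Finset.sum_congr rfl fun f _ => ?_
  rw [Finset.sum_comm]
  refine Finset.sum_congr rfl fun i _ => Finset.sum_congr rfl fun j _ => ?_
  ring

end Kraus

/-! ### Rates -/

lemma log2_coe (n : ℕ) : log2 (n : ℕ∞) = ((Real.logb 2 n : ℝ) : EReal) := rfl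

lemma log2_nonneg (x : ℕ∞) : 0 ≤ log2 x := by
  induction x using ENat.recTopCoe with
  | top => exact le_top
  | coe n =>
    rw [log2_coe]
    -- `Real.logb 2 0 = 0`, so an empty code does not make the rate negative.
    rcases Nat.eq_zero_or_pos n with rfl | hn
    · simp
    · exact_mod_cast Real.logb_nonneg one_lt_two (by exact_mod_cast hn)

lemma log2_mono : Monotone log2 := by
  intro x y h
  induction y using ENat.recTopCoe with
  | top => exact le_top
  | coe m =>
    lift x to ℕ using ne_top_of_le_ne_top (ENat.natCast_ne_top m) h
    rcases Nat.eq_zero_or_pos x with rfl | hx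
    · exact (log2_coe 0).trans_le (by simpa using log2_nonneg m)
    · rw [log2_coe, log2_coe]
      have h' : (x : ℝ) ≤ m := by exact_mod_cast h
      exact_mod_cast Real.logb_le_logb_of_le one_lt_two (by exact_mod_cast hx) h'

lemma rate_mono {α β : ℕ → ℕ∞} (h : ∀ k, α k ≤ β k) : rate α ≤ rate β :=
  iSup₂_mono fun k _ => EReal.div_le_div_right_of_nonneg (by positivity) (log2_mono (h k))

/-- The term `k = 1`; all lower bounds on assisted and joint capacities come from it. -/
lemma log2_le_rate (α : ℕ → ℕ∞) : log2 (α 1) ≤ rate α := by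
  have := le_iSup₂ (f := fun (k : ℕ) (_ : 1 ≤ k) => log2 (α k) / ((k : ℝ) : EReal)) 1 le_rfl
  simpa [rate] using this

lemma rate_eq_zero {α : ℕ → ℕ∞} (h : ∀ k, α k ≤ 1) : rate α = 0 := by
  refine le_antisymm (iSup₂_le fun k _ => ?_) ((log2_nonneg _).trans (log2_le_rate α))
  have : log2 (α k) = 0 :=
    le_antisymm ((log2_mono (h k)).trans_eq (by simpa using log2_coe 1)) (log2_nonneg _)
  simp [this]

lemma rate_le_one {α : ℕ → ℕ∞} (h : ∀ k, α k ≤ (2 ^ k : ℕ)) : rate α ≤ 1 := by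
  refine iSup₂_le fun k hk => ?_
  have hk' : (0 : EReal) < ((k : ℝ) : EReal) := by exact_mod_cast hk
  rw [EReal.div_le_iff_le_mul hk' (EReal.coe_ne_top _), mul_one]
  refine (log2_mono (h k)).trans_eq ?_
  rw [log2_coe]
  simp [Real.logb_pow]

/-! ### Perfect distinguishability -/

section Distinguish

variable {a b : Type} [Fintype a] [DecidableEq a] [Fintype b] [DecidableEq b]

lemma single_eq_pureState {N : ℕ} (i : Fin N) :
    Matrix.single i i (1 : ℂ) = pureState (Pi.single i 1) := by
  ext m n
  simp [pureState, Matrix.vecMulVec_apply, Matrix.single_apply, Pi.single_apply, ite_and, @eq_comm _ i]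
  split_ifs <;> rfl

lemma posSemidef_pureState (ψ : a → ℂ) : (pureState ψ).PosSemidef :=
  Matrix.posSemidef_vecMulVec_self_star ψ

lemma single_diag_of_ne {N : ℕ} {i j : Fin N} (h : i ≠ j) : Matrix.single i i (1 : ℂ) j j = 0 :=
  Matrix.single_apply_of_ne _ _ _ _ _ fun h' => h h'.1

lemma isState_single {N : ℕ} (i : Fin N) : IsState (Matrix.single i i (1 : ℂ)) :=
  ⟨single_eq_pureState i ▸ posSemidef_pureState _, Matrix.trace_single_eq_same i 1⟩

/-- The measurement that applies the channel `D` and then measures in the standard basis. -/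
lemma perfectlyDistinguishable_of_channel {N : ℕ} {D : SuperOp b (Fin N)} (hD : IsChannel D)
    {σ : Fin N → Matrix b b ℂ} (h : ∀ i j, i ≠ j → D (σ i) j j = 0) :
    PerfectlyDistinguishable σ := by
  obtain ⟨n, K, rfl⟩ := hD.1.exists_krausMap
  have hK := sum_kraus_eq_one hD.2
  refine ⟨fun j => ∑ k, (K k).conjTranspose * Matrix.single j j (1 : ℂ) * K k, fun j => ?_, ?_,
    fun i j hij => ?_⟩
  · exact Matrix.posSemidef_sum _ fun k _ =>
      (isState_single j).1.conjTranspose_mul_mul_same _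
  · rw [Finset.sum_comm, ← hK]
    refine Finset.sum_congr rfl fun k _ => ?_
    rw [← Matrix.sum_mul, ← Matrix.mul_sum, Matrix.sum_single_one, Matrix.mul_one]
  · change ((∑ k, (K k).conjTranspose * Matrix.single j j (1 : ℂ) * K k) * σ i).trace = 0
    rw [← trace_mul_krausMap, Matrix.trace_single_mul, one_smul]
    exact h i j hij

open scoped MatrixOrder Matrix.Norms.L2Operator in
lemma exists_eq_conjTranspose_mul_self {A : Matrix a a ℂ} (hA : A.PosSemidef) :
    ∃ C : Matrix a a ℂ, A = Cᴴ * C :=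
  CStarAlgebra.nonneg_iff_eq_star_mul_self.mp hA.nonneg

/-- With `M = Bᴴ * B` and `A = Cᴴ * C`, the trace is the squared Hilbert–Schmidt norm of `B * Cᴴ`.
-/
lemma posSemidef_mul_eq_zero {M A : Matrix b b ℂ} (hM : M.PosSemidef) (hA : A.PosSemidef)
    (h : (M * A).trace = 0) : M * A = 0 := by
  obtain ⟨B, rfl⟩ := exists_eq_conjTranspose_mul_self hM
  obtain ⟨C, rfl⟩ := exists_eq_conjTranspose_mul_self hA
  have : (B * C.conjTranspose) = 0 := by
    rw [← Matrix.trace_conjTranspose_mul_self_eq_zero_iff, Matrix.conjTranspose_mul,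
      Matrix.conjTranspose_conjTranspose, Matrix.mul_assoc, Matrix.trace_mul_comm]
    simpa only [Matrix.mul_assoc] using h
  rw [Matrix.mul_assoc, ← Matrix.mul_assoc B, this, Matrix.zero_mul, Matrix.mul_zero]

/-- Distinguishable states have orthogonal supports. -/
lemma PerfectlyDistinguishable.mul_eq_zero {N : ℕ} {σ : Fin N → Matrix b b ℂ}
    (h : PerfectlyDistinguishable σ) (hσ : ∀ i, (σ i).PosSemidef) {i j : Fin N} (hij : i ≠ j) :
    σ i * σ j = 0 := by
  obtain ⟨M, hM, hM1, hM0⟩ := h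
  have h0 (k l : Fin N) (hkl : k ≠ l) : M l * σ k = 0 :=
    posSemidef_mul_eq_zero (hM l) (hσ k) (hM0 k l hkl)
  calc σ i * σ j = ∑ l, σ i * M l * σ j := by
        rw [← Matrix.sum_mul, ← Matrix.mul_sum, hM1, mul_one]
    _ = 0 := Finset.sum_eq_zero fun l _ => by
        by_cases hl : j = l
        · have := congrArg Matrix.conjTranspose (h0 i l (hl ▸ hij))
          rw [Matrix.conjTranspose_mul, (hM l).1.eq, (hσ i).1.eq, Matrix.conjTranspose_zero] at this
          rw [this, Matrix.zero_mul]
        · rw [Matrix.mul_assoc, h0 j l hl, Matrix.mul_zero]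

/-- A space of dimension `n` has at most `n` perfectly distinguishable states. -/
lemma PerfectlyDistinguishable.le_card {N : ℕ} {σ : Fin N → Matrix b b ℂ}
    (h : PerfectlyDistinguishable σ) (hσ : ∀ i, IsState (σ i)) : N ≤ Fintype.card b := by
  have hne (i : Fin N) : ∃ v : b → ℂ, σ i *ᵥ v ≠ 0 := by
    by_contra! hv
    have h0 : σ i = 0 := Matrix.ext_of_mulVec_single fun j => by rw [hv, Matrix.zero_mulVec]
    simpa [h0] using (hσ i).2
  choose v hv using hne
  have hli : LinearIndependent ℂ fun i => σ i *ᵥ v i := by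
    rw [Fintype.linearIndependent_iff]
    intro g hg i
    -- Orthogonality of supports leaves only `g i` times `σ i ^ 2` applied to `v i`. This vector is
    -- nonzero because `σ i` is Hermitian and `σ i *ᵥ v i` is nonzero.
    have h1 := congrArg (σ i *ᵥ ·) hg
    simp only [Matrix.mulVec_sum, Matrix.mulVec_smul, Matrix.mulVec_zero, Matrix.mulVec_mulVec]
      at h1
    rw [Finset.sum_eq_single i (fun j _ hj => by
      rw [h.mul_eq_zero (fun k => (hσ k).1) hj.symm, Matrix.zero_mulVec, smul_zero])
      (by simp)] at h1
    refine (smul_eq_zero.mp h1).resolve_right fun h2 => hv i ?_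
    rwa [← Matrix.conjTranspose_mul_self_mulVec_eq_zero, (hσ i).1.1.eq]
  simpa using hli.fintype_card_le_finrank

end Distinguish

/-! ### Quantum codes give classical codes -/

section Compare

variable {a b : Type} [Fintype a] [DecidableEq a] [Fintype b] [DecidableEq b]

/-- The encoded basis vectors form a classical code: decode, then measure in the standard basis. -/
lemma quantumCliqueDim_le_cliqueNumber (Φ : SuperOp a b) :
    quantumCliqueDim Φ ≤ cliqueNumber Φ := by
  refine iSup_mono fun N => iSup_const_mono ?_
  rintro ⟨V, D, hV, hD, h⟩
  refine ⟨fun i => V * Matrix.single i i (1 : ℂ) * Vᴴ, fun i => ⟨?_, ?_⟩,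
    perfectlyDistinguishable_of_channel hD fun i j hij => ?_⟩
  · exact (isState_single i).1.mul_mul_conjTranspose_same _
  · rw [Matrix.trace_mul_comm, ← Matrix.mul_assoc, hV, Matrix.one_mul, (isState_single i).2]
  · change D (Φ (V * Matrix.single i i (1 : ℂ) * Vᴴ)) j j = 0
    rw [single_eq_pureState, h, ← single_eq_pureState, single_diag_of_ne hij]

/-- Preparation of an auxiliary system in the state `i`. -/
lemma isChannel_prepare {N : ℕ} (i : Fin N) :
    IsChannel (krausMap fun _ : Unit => (Matrix.of fun (p : a × Fin N) (q : a) =>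
      if p.1 = q ∧ p.2 = i then (1 : ℂ) else 0)) := by
  refine isChannel_krausMap ?_
  ext p q
  simp [Matrix.mul_apply, Fintype.sum_prod_type, Matrix.one_apply, ite_and, eq_comm]

lemma prepare_apply {N : ℕ} (i : Fin N) (X : Matrix a a ℂ) :
    krausMap (fun _ : Unit => (Matrix.of fun (p : a × Fin N) (q : a) =>
      if p.1 = q ∧ p.2 = i then (1 : ℂ) else 0)) X = X ⊗ₖ Matrix.single i i 1 := by
  ext u v
  simp [krausMap_apply, Matrix.mul_apply, Matrix.single_apply, ite_and, @eq_comm _ i]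
  split_ifs <;> simp

/-- The sender prepares the basis state `i` locally and feeds it to the quantum encoder as the
message. -/
lemma quantumCliqueDimEbit_le_cliqueNumberEbit (Φ : SuperOp a b) :
    quantumCliqueDimEbit Φ ≤ cliqueNumberEbit Φ := by
  refine iSup_mono fun N => iSup_const_mono ?_
  rintro ⟨enc, D, henc, hD, h⟩
  refine ⟨fun i => enc ∘ₗ krausMap fun _ : Unit => (Matrix.of fun p q =>
      if p.1 = q ∧ p.2 = i then (1 : ℂ) else 0), fun i => henc.comp (isChannel_prepare i),
    perfectlyDistinguishable_of_channel hD fun i j hij => ?_⟩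
  have key : tensorMap (LinearMap.id : SuperOp (Fin 2) (Fin 2))
      (Φ ∘ₗ enc ∘ₗ krausMap fun _ : Unit => (Matrix.of fun p q =>
        if p.1 = q ∧ p.2 = i then (1 : ℂ) else 0)) bell
      = tensorMap (LinearMap.id : SuperOp (Fin 2) (Fin 2)) (Φ ∘ₗ enc)
        ((bell ⊗ₖ Matrix.single i i 1).submatrix
          (Equiv.prodAssoc (Fin 2) (Fin 2) (Fin N)).symm
          (Equiv.prodAssoc (Fin 2) (Fin 2) (Fin N)).symm) := by
    ext p q
    change Φ (enc (krausMap _ _)) p.2 q.2 = Φ (enc _) p.2 q.2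
    rw [prepare_apply]
    rfl
  rw [key, single_eq_pureState, h, ← single_eq_pureState,
    single_diag_of_ne hij]

lemma posSemidef_bobState {M R S : Type} [Fintype M] [Fintype R] [Fintype S]
    {X : Matrix (M × R × S) (M × R × S) ℂ} (hX : X.PosSemidef) : (bobState X).PosSemidef := by
  have : bobState X = ∑ m, ∑ r, X.submatrix (fun s => (m, r, s)) (fun s => (m, r, s)) := by
    ext s s'
    simp [bobState, Matrix.sum_apply]
  rw [this]
  exact Matrix.posSemidef_sum _ fun m _ => Matrix.posSemidef_sum _ fun r _ => hX.submatrix _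

lemma Reachable.posSemidef {E : SuperOp a b} (hE : IsCP E) {N n : ℕ} {P : Stage N}
    (hP : Reachable E n P) {ρ : Matrix (Fin N) (Fin N) ℂ} (hρ : ρ.PosSemidef) (t : P.T) :
    (P.branch t ρ).PosSemidef := by
  induction hP with
  | init σ hσ => exact hρ.kronecker (hσ.1.kronecker Matrix.PosSemidef.one)
  | alice _ J hJ ih => exact (isCP_id.tensorMap (((hJ _).1 _).tensorMap isCP_id)).posSemidef (ih _)
  | bob _ J hJ ih => exact (isCP_id.tensorMap (isCP_id.tensorMap ((hJ _).1 _))).posSemidef (ih _)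
  | use _ e W hW ih =>
    exact ((((isCP_id.tensorMap hE).comp (hW _).1).tensorMap isCP_id).posSemidef
      ((ih _).submatrix _)).submatrix _

lemma quantumCliqueDimTwoWay_le_cliqueNumberTwoWay {E : SuperOp a b} (hE : IsCP E) (n : ℕ) :
    quantumCliqueDimTwoWay E n ≤ cliqueNumberTwoWay E n := by
  refine iSup_mono fun N => iSup_const_mono ?_
  rintro ⟨P, D, hP, hD, htr, h⟩
  refine ⟨P, hP, fun t i j => htr t _ _ (isState_single i) (isState_single j), fun t =>
    perfectlyDistinguishable_of_channel (hD t) fun i j hij => ?_⟩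
  have h0 := congrFun (congrFun (h (Pi.single i 1)) j) j
  rw [← single_eq_pureState, single_diag_of_ne hij, Matrix.sum_apply] at h0
  refine (Finset.sum_eq_zero_iff_of_nonneg fun t _ => ?_).mp h0 t (Finset.mem_univ t)
  -- Only the sum over transcripts is known to vanish at the wrong outcome `j`. Its terms are
  -- diagonal entries of positive operators, so each transcript is free of error by itself.
  exact ((hD t).1.posSemidef
    (posSemidef_bobState (hP.posSemidef hE (isState_single i).1 t))).diag_nonneg

end Compare

/-! ### A single use -/

section SingleUse

variable {a b : Type} [Fintype a] [DecidableEq a] [Fintype b] [DecidableEq b]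

/-- Rates see only tensor powers; this identification turns codes for the channel itself into codes
for its first power. -/
lemma tensorPow_one (Φ : SuperOp a b) :
    tensorPow Φ 1 = relabel (Equiv.funUnique (Fin 1) b) ∘ₗ Φ ∘ₗ
      relabel (Equiv.funUnique (Fin 1) a).symm := by
  refine Matrix.ext_linearMap ℂ fun p q => LinearMap.ext_ring ?_
  ext f g
  change ∑ i : Fin 1 → a, ∑ j : Fin 1 → a, Matrix.single p q (1 : ℂ) i j *
    ∏ t, Φ (Matrix.single (i t) (j t) 1) (f t) (g t) = Φ (relabel _ _) (f 0) (g 0)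
  have : relabel (Equiv.funUnique (Fin 1) a).symm (Matrix.single p q (1 : ℂ))
      = Matrix.single (p 0) (q 0) 1 := by
    rw [relabel_apply, Matrix.submatrix_single_equiv]
    rfl
  simp [this, Matrix.single_apply, ite_and]

lemma relabel_symm_comp (f : b ≃ a) (X : Matrix a a ℂ) : relabel f.symm (relabel f X) = X := by
  simp [relabel_apply]

lemma quantumCliqueDim_le_tensorPow_one (Φ : SuperOp a b) :
    quantumCliqueDim Φ ≤ quantumCliqueDim (tensorPow Φ 1) := by
  refine iSup_mono fun N => iSup_const_mono ?_
  rintro ⟨V, D, hV, hD, h⟩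
  refine ⟨V.submatrix (Equiv.funUnique (Fin 1) a) id,
    D ∘ₗ relabel (Equiv.funUnique (Fin 1) b).symm, ?_, hD.comp (isChannel_relabel _), fun ψ => ?_⟩
  · rw [Matrix.conjTranspose_submatrix, Matrix.submatrix_mul_equiv, hV, Matrix.submatrix_id_id]
  · refine Eq.trans ?_ (h ψ)
    rw [tensorPow_one]
    simp only [LinearMap.comp_apply, relabel_symm_comp]
    congr 2

lemma quantumCliqueDimEbit_le_tensorPow_one (Φ : SuperOp a b) :
    quantumCliqueDimEbit Φ ≤ quantumCliqueDimEbit (tensorPow Φ 1) := by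
  refine iSup_mono fun N => iSup_const_mono ?_
  rintro ⟨enc, D, henc, hD, h⟩
  refine ⟨relabel (Equiv.funUnique (Fin 1) a) ∘ₗ enc,
    D ∘ₗ relabel ((Equiv.refl (Fin 2)).prodCongr (Equiv.funUnique (Fin 1) b).symm),
    (isChannel_relabel _).comp henc, hD.comp (isChannel_relabel _), fun ψ => ?_⟩
  refine Eq.trans ?_ (h ψ)
  rw [tensorPow_one]
  simp only [LinearMap.comp_apply]
  congr 1

lemma log2_le_zeroErrorQ (Φ : SuperOp a b) : log2 (quantumCliqueDim Φ) ≤ zeroErrorQ Φ :=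
  (log2_mono (quantumCliqueDim_le_tensorPow_one Φ)).trans
    (log2_le_rate fun k => quantumCliqueDim (tensorPow Φ k))

lemma log2_le_zeroErrorQEbit (Φ : SuperOp a b) :
    log2 (quantumCliqueDimEbit Φ) ≤ zeroErrorQEbit Φ :=
  (log2_mono (quantumCliqueDimEbit_le_tensorPow_one Φ)).trans
    (log2_le_rate fun k => quantumCliqueDimEbit (tensorPow Φ k))

end SingleUse

lemma zeroErrorQ_le_zeroErrorC {a b : Type} [Fintype a] [DecidableEq a] [Fintype b]
    [DecidableEq b] (Φ : SuperOp a b) : zeroErrorQ Φ ≤ zeroErrorC Φ :=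
  rate_mono fun _ => quantumCliqueDim_le_cliqueNumber _

lemma zeroErrorQEbit_le_zeroErrorCEbit {a b : Type} [Fintype a] [DecidableEq a] [Fintype b]
    [DecidableEq b] (Φ : SuperOp a b) : zeroErrorQEbit Φ ≤ zeroErrorCEbit Φ :=
  rate_mono fun _ => quantumCliqueDimEbit_le_cliqueNumberEbit _

lemma zeroErrorQTwoWay_le_zeroErrorCTwoWay {a b : Type} [Fintype a] [DecidableEq a] [Fintype b]
    [DecidableEq b] {Φ : SuperOp a b} (hΦ : IsCP Φ) : zeroErrorQTwoWay Φ ≤ zeroErrorCTwoWay Φ :=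
  rate_mono fun _ => quantumCliqueDimTwoWay_le_cliqueNumberTwoWay hΦ _

/-! ### The noiseless qubit channel -/

lemma tensorPow_id (n : ℕ) {a : Type} [Fintype a] [DecidableEq a] :
    tensorPow (LinearMap.id : SuperOp a a) n = LinearMap.id := by
  refine Matrix.ext_linearMap ℂ fun p q => LinearMap.ext_ring ?_
  ext f g
  change ∑ i : Fin n → a, ∑ j : Fin n → a, Matrix.single p q (1 : ℂ) i j *
    ∏ t, (Matrix.single (i t) (j t) (1 : ℂ) : Matrix a a ℂ) (f t) (g t) = Matrix.single p q 1 f g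
  have (i j : Fin n → a) : ∏ t, (Matrix.single (i t) (j t) (1 : ℂ) : Matrix a a ℂ) (f t) (g t)
      = Matrix.single i j 1 f g := by
    simp only [Matrix.single_apply, Finset.prod_ite_zero, Finset.prod_const_one, funext_iff,
      forall_and, Finset.mem_univ, true_imp_iff]
  simp only [this]
  simp [Matrix.single_apply, ite_and]

lemma zeroErrorC_idQubit_le : zeroErrorC idQubit ≤ 1 := by
  refine rate_le_one fun k => iSup₂_le ?_
  rintro N ⟨ρ, hρ, h⟩
  rw [idQubit, tensorPow_id] at h
  have := h.le_card hρ
  simp only [Fintype.card_fun, Fintype.card_fin] at this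
  exact_mod_cast this

lemma le_zeroErrorQ_idQubit : 1 ≤ zeroErrorQ idQubit := by
  have h2 : ((2 : ℕ) : ℕ∞) ≤ quantumCliqueDim idQubit :=
    le_iSup₂_of_le (i := 2) ⟨1, LinearMap.id, by simp, ⟨isCP_id, fun _ => rfl⟩,
      fun ψ => by simp [idQubit]⟩ le_rfl
  refine le_trans ?_ ((log2_mono h2).trans (log2_le_zeroErrorQ idQubit))
  rw [log2_coe]
  simp

lemma zeroErrorC_idQubit : zeroErrorC idQubit = 1 :=
  zeroErrorC_idQubit_le.antisymm (le_zeroErrorQ_idQubit.trans (zeroErrorQ_le_zeroErrorC _))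

lemma zeroErrorQ_idQubit : zeroErrorQ idQubit = 1 :=
  ((zeroErrorQ_le_zeroErrorC _).trans zeroErrorC_idQubit_le).antisymm le_zeroErrorQ_idQubit

/-! ### Channels with vanishing zero-error capacity -/

section Vanishing

variable {a b κ : Type} [Fintype a] [DecidableEq a] [Fintype b] [DecidableEq b] [Fintype κ]

lemma trace_mul_nonneg {A B : Matrix a a ℂ} (hA : A.PosSemidef) (hB : B.PosSemidef) :
    0 ≤ (A * B).trace := by
  obtain ⟨C, rfl⟩ := exists_eq_conjTranspose_mul_self hA
  rw [Matrix.mul_assoc, Matrix.trace_mul_comm]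
  exact (hB.mul_mul_conjTranspose_same C).trace_nonneg

/-- The trace of the product of the two outputs is a sum of nonnegative terms over pairs of Kraus
indices, so each term vanishes. The term with both indices equal to `k` is the squared
Hilbert–Schmidt norm of `C * ((K k)ᴴ * K k) * Dᴴ`, where `A = Cᴴ * C` and `B = Dᴴ * D`. -/
lemma krausMap_orthogonal (K : κ → Matrix b a ℂ) {A B : Matrix a a ℂ} (hA : A.PosSemidef)
    (hB : B.PosSemidef) (h : krausMap K A * krausMap K B = 0) (k : κ) :
    A * ((K k)ᴴ * K k) * B = 0 := by
  have hpos (l m : κ) : 0 ≤ ((K l * A * (K l)ᴴ) * (K m * B * (K m)ᴴ)).trace :=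
    trace_mul_nonneg (hA.mul_mul_conjTranspose_same _) (hB.mul_mul_conjTranspose_same _)
  have h0 := congrArg Matrix.trace h
  rw [krausMap_apply, krausMap_apply, Finset.sum_mul_sum, Matrix.trace_sum, Matrix.trace_zero]
    at h0
  simp only [Matrix.trace_sum] at h0
  have h1 := (Finset.sum_eq_zero_iff_of_nonneg fun l _ => Finset.sum_nonneg fun m _ =>
    hpos l m).mp h0 k (Finset.mem_univ k)
  have h2 := (Finset.sum_eq_zero_iff_of_nonneg fun m _ => hpos k m).mp h1 k (Finset.mem_univ k)
  obtain ⟨C, rfl⟩ := exists_eq_conjTranspose_mul_self hA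
  obtain ⟨D, rfl⟩ := exists_eq_conjTranspose_mul_self hB
  have h3 : (C * ((K k)ᴴ * K k) * Dᴴ) = 0 := by
    rw [← Matrix.trace_mul_conjTranspose_self_eq_zero_iff, ← h2]
    calc (C * ((K k)ᴴ * K k) * Dᴴ * (C * ((K k)ᴴ * K k) * Dᴴ)ᴴ).trace
        = (C * ((K k)ᴴ * K k * (Dᴴ * D) * ((K k)ᴴ * K k) * Cᴴ)).trace := by
          simp only [Matrix.conjTranspose_mul, Matrix.conjTranspose_conjTranspose,
            Matrix.mul_assoc]
      _ = ((K k)ᴴ * K k * (Dᴴ * D) * (K k)ᴴ * (K k * (Cᴴ * C))).trace := by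
          rw [Matrix.trace_mul_comm]
          simp only [Matrix.mul_assoc]
      _ = (K k * (Cᴴ * C) * (K k)ᴴ * (K k * (Dᴴ * D) * (K k)ᴴ)).trace := by
          rw [Matrix.trace_mul_comm]
          simp only [Matrix.mul_assoc]
  calc Cᴴ * C * ((K k)ᴴ * K k) * (Dᴴ * D) = Cᴴ * (C * ((K k)ᴴ * K k) * Dᴴ) * D := by
        simp only [Matrix.mul_assoc]
    _ = 0 := by rw [h3, Matrix.mul_zero, Matrix.zero_mul]

/-- Peel off the first factor. Freezing the other coordinates where `ψ` and `φ` are nonzero gives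
two nonzero vectors on one factor; the `p` that `H` supplies for them makes both partial
contractions nonzero on the remaining factors, and induction applies. -/
lemma exists_prod_contraction {A P : Type} [Fintype A] {α β : P → A → ℂ}
    (H : ∀ ψ φ : A → ℂ, ψ ≠ 0 → φ ≠ 0 → ∃ p, ∑ x, ψ x * α p x ≠ 0 ∧ ∑ x, β p x * φ x ≠ 0)
    (n : ℕ) (ψ φ : (Fin n → A) → ℂ) (hψ : ψ ≠ 0) (hφ : φ ≠ 0) :
    ∃ p : Fin n → P, ∑ i, ψ i * ∏ t, α (p t) (i t) ≠ 0 ∧ ∑ i, (∏ t, β (p t) (i t)) * φ i ≠ 0 := by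
  induction n with
  | zero =>
    refine ⟨Fin.elim0, ?_, ?_⟩
    · simpa [funext_iff, Unique.forall_iff] using hψ
    · simpa [funext_iff, Unique.forall_iff] using hφ
  | succ n ih =>
    obtain ⟨i, hi⟩ := Function.ne_iff.mp hψ
    obtain ⟨j, hj⟩ := Function.ne_iff.mp hφ
    obtain ⟨p, hp, hp'⟩ := H (fun x => ψ (Fin.cons x (Fin.tail i)))
      (fun x => φ (Fin.cons x (Fin.tail j)))
      (Function.ne_iff.mpr ⟨i 0, by simpa using hi⟩) (Function.ne_iff.mpr ⟨j 0, by simpa using hj⟩)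
    obtain ⟨q, hq, hq'⟩ := ih (fun u => ∑ x, ψ (Fin.cons x u) * α p x)
      (fun u => ∑ x, β p x * φ (Fin.cons x u))
      (Function.ne_iff.mpr ⟨_, hp⟩) (Function.ne_iff.mpr ⟨_, hp'⟩)
    refine ⟨Fin.cons p q, ?_, ?_⟩
    · rw [← (Fin.consEquiv fun _ => A).sum_comp, Fintype.sum_prod_type, Finset.sum_comm]
      simpa [Fin.consEquiv, Fin.prod_univ_succ, Finset.sum_mul, mul_assoc] using hq
    · rw [← (Fin.consEquiv fun _ => A).sum_comp, Fintype.sum_prod_type, Finset.sum_comm]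
      simpa [Fin.consEquiv, Fin.prod_univ_succ, Finset.mul_sum, mul_assoc, mul_left_comm,
        mul_comm] using hq'

/-- If rank-one operators `|α p⟩⟨β p|` that detect every pair of vectors lie in the span of the
operators `(K f)ᴴ * K f`, then no tensor power of the channel can distinguish two states. -/
lemma cliqueNumber_tensorPow_le_one {P : Type} {K : κ → Matrix b a ℂ} {α β : P → a → ℂ}
    (hK : ∀ p, ∃ c : κ → ℂ, ∑ f, c f • ((K f)ᴴ * K f) = Matrix.vecMulVec (α p) (β p))
    (H : ∀ ψ φ : a → ℂ, ψ ≠ 0 → φ ≠ 0 → ∃ p, ∑ x, ψ x * α p x ≠ 0 ∧ ∑ x, β p x * φ x ≠ 0)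
    (n : ℕ) : cliqueNumber (tensorPow (krausMap K) n) ≤ 1 := by
  refine iSup₂_le ?_
  rintro N ⟨ρ, hρ, h⟩
  by_contra! hN
  have hN' : 1 < N := by exact_mod_cast hN
  set i : Fin N := ⟨0, by omega⟩
  set j : Fin N := ⟨1, hN'⟩
  rw [tensorPow_krausMap] at h
  have horth := krausMap_orthogonal _ (hρ i).1 (hρ j).1
    (h.mul_eq_zero (fun k => (isCP_krausMap _).posSemidef (hρ k).1)
      (show i ≠ j by simp [i, j, Fin.ext_iff]))
  have hne (k : Fin N) : ρ k ≠ 0 := fun h0 => by simpa [h0] using (hρ k).2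
  -- A nonzero row `u` of `ρ i` and a nonzero column `v` of `ρ j` are the vectors to be connected:
  -- the entry `(u, v)` of `ρ i * |α⟩⟨β| * ρ j` is the product of the two contractions.
  obtain ⟨u, hu⟩ := Function.ne_iff.mp (hne i)
  obtain ⟨v, hv⟩ := Function.ne_iff.mp fun h0 => hne j (Matrix.transpose_eq_zero.mp h0)
  obtain ⟨p, hp, hp'⟩ := exists_prod_contraction H n _ _ hu hv
  choose c hc using hK
  -- The span passes to tensor powers, with products of the one-factor coefficients.
  have hcomb : ∑ f : Fin n → κ, (∏ t, c (p t) (f t)) •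
      ((krausPow K n f)ᴴ * krausPow K n f)
      = Matrix.vecMulVec (fun i => ∏ t, α (p t) (i t)) (fun i => ∏ t, β (p t) (i t)) := by
    ext x y
    have hent (t : Fin n) : α (p t) (x t) * β (p t) (y t)
        = ∑ f, c (p t) f * ∑ l, star (K f l (x t)) * K f l (y t) := by
      rw [← Matrix.vecMulVec_apply, ← hc]
      simp [Matrix.sum_apply, Matrix.mul_apply]
    rw [Matrix.vecMulVec_apply, ← Finset.prod_mul_distrib, Finset.prod_congr rfl fun t _ => hent t]
    simp only [Finset.prod_univ_sum, Fintype.piFinset_univ, Finset.prod_mul_distrib,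
      Matrix.sum_apply, Matrix.smul_apply, smul_eq_mul, Matrix.mul_apply,
      Matrix.conjTranspose_apply, krausPow, Matrix.of_apply, star_prod]
  have h0 : ρ i * Matrix.vecMulVec (fun i => ∏ t, α (p t) (i t)) (fun i => ∏ t, β (p t) (i t))
      * ρ j = 0 := by
    rw [← hcomb, Matrix.mul_sum, Matrix.sum_mul]
    refine Finset.sum_eq_zero fun f _ => ?_
    rw [Matrix.mul_smul, Matrix.smul_mul, horth f, smul_zero]
  rw [Matrix.mul_vecMulVec, Matrix.vecMulVec_mul] at h0
  have h1 := congrFun (congrFun h0 u) v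
  exact mul_ne_zero hp hp' h1

end Vanishing

/-! ### The channel -/

/-- Three rotations of the plane, any two of whose axes are different. -/
def rot : Fin 3 → Matrix (Fin 2) (Fin 2) ℂ :=
  ![!![1, 0; 0, 1], !![0, 1; -1, 0], !![3 / 5, 4 / 5; -4 / 5, 3 / 5]]

lemma rot_mul_conjTranspose (x : Fin 3) : rot x * (rot x)ᴴ = 1 := by
  ext i j
  fin_cases x <;> fin_cases i <;> fin_cases j <;>
    simp [rot, Matrix.mul_apply, Fin.sum_univ_two, Complex.conj_ofNat] <;> norm_num

lemma sum_rot_row (x : Fin 3) (i j : Fin 2) :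
    ∑ k, rot x i k * star (rot x j k) = (1 : Matrix (Fin 2) (Fin 2) ℂ) i j := by
  rw [← rot_mul_conjTranspose x, Matrix.mul_apply]
  rfl

lemma sum_rot_col (x : Fin 3) (k l : Fin 2) :
    ∑ i, star (rot x i k) * rot x i l = (1 : Matrix (Fin 2) (Fin 2) ℂ) k l := by
  rw [← mul_eq_one_comm.mp (rot_mul_conjTranspose x), Matrix.mul_apply]
  rfl

section Channel

variable {d : ℕ}

/-- The classical information in the output of the channel. -/
abbrev Flag (d : ℕ) : Type := (Fin 3 × Fin d × Fin d) × Fin 4 × Fin 2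

/-- A transposition, followed by a change of sign of one column if `s = 1`. -/
def signedSwap (x : Fin 3 × Fin d × Fin d) (s : Fin 2) : Matrix (Fin d) (Fin d) ℂ :=
  Matrix.of fun p q =>
    if p = Equiv.swap x.2.1 x.2.2 q then (if s = 1 ∧ q = x.2.2 then -1 else 1) else 0

lemma star_signedSwap (x : Fin 3 × Fin d × Fin d) (s : Fin 2) (p q : Fin d) :
    star (signedSwap x s p q) = signedSwap x s p q := by
  simp only [signedSwap, Matrix.of_apply]
  split_ifs <;> simp

/-- The sign touches a single column, whose only entry the transposition puts in row `x.2.1`. Thus a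
matrix unit is half the difference of two unitaries. -/
lemma signedSwap_sub (x : Fin 3 × Fin d × Fin d) (p q : Fin d) :
    signedSwap x 0 p q - signedSwap x 1 p q
      = 2 * ((if p = x.2.1 then 1 else 0) * if q = x.2.2 then 1 else 0) := by
  by_cases hq : q = x.2.2
  · by_cases hp : p = x.2.1
    · simp [signedSwap, hp, hq]
      norm_num
    · simp [signedSwap, hp, hq]
  · simp [signedSwap, hq]

/-- A signed transposition with a phase. -/
def kick (f : Flag d) : Matrix (Fin d) (Fin d) ℂ :=
  Matrix.of fun p q => Complex.I ^ (f.2.1 : ℕ) * signedSwap f.1 f.2.2 p q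

lemma star_kick (f : Flag d) (p q : Fin d) :
    star (kick f p q) = (-Complex.I) ^ (f.2.1 : ℕ) * signedSwap f.1 f.2.2 p q := by
  simp only [kick, Matrix.of_apply, star_mul', star_signedSwap, star_pow, Complex.star_def,
    Complex.conj_I]

lemma kick_unitary (f : Flag d) : (kick f)ᴴ * kick f = 1 := by
  ext p q
  rw [Matrix.mul_apply]
  have h (k : Fin d) : (kick f)ᴴ p k * kick f k q
      = signedSwap f.1 f.2.2 k p * signedSwap f.1 f.2.2 k q := by
    rw [Matrix.conjTranspose_apply, star_kick, kick, Matrix.of_apply, mul_mul_mul_comm, ← mul_pow]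
    simp
  simp only [h, signedSwap, Matrix.of_apply, Matrix.one_apply, ite_mul, zero_mul, mul_ite,
    mul_zero, Finset.sum_ite_eq', Finset.mem_univ, if_true, EmbeddingLike.apply_eq_iff_eq]
  by_cases h : p = q
  · subst h
    simp
    split_ifs <;> simp
  · simp [h, Ne.symm h]

lemma sum_kick_col (f : Flag d) (m n : Fin d) :
    ∑ k, star (kick f k m) * kick f k n = (1 : Matrix (Fin d) (Fin d) ℂ) m n := by
  rw [← kick_unitary f, Matrix.mul_apply]
  rfl

/-- The operator applied to the message, according to the outcome of the measurement of the
qubit. -/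
def kicks (f : Flag d) : Fin 2 → Matrix (Fin d) (Fin d) ℂ := ![1, kick f]

lemma kicks_unitary (f : Flag d) (i : Fin 2) : (kicks f i)ᴴ * kicks f i = 1 := by
  fin_cases i
  · simp [kicks]
  · exact kick_unitary f

/-- The operator `∑ i, ⟨i|O ⊗ W i`, where `O = rot x` and `W = kicks f`. -/
def block (f : Flag d) : Matrix (Fin d) (Fin 2 × Fin d) ℂ :=
  Matrix.of fun m q => ∑ i, rot f.1.1 i q.1 * kicks f i m q.2

/-- Both diagonal terms carry the identity on the message, by unitarity, and the basis projections
add up to the identity on the qubit; only the interference terms remain. -/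
lemma block_gram (f : Flag d) (k l : Fin 2) (m n : Fin d) :
    ∑ r, star (block f r (k, m)) * block f r (l, n)
      = (1 : Matrix (Fin 2 × Fin d) (Fin 2 × Fin d) ℂ) (k, m) (l, n)
        + star (rot f.1.1 0 k) * rot f.1.1 1 l * kick f m n
        + star (rot f.1.1 1 k) * rot f.1.1 0 l * star (kick f n m) := by
  have h1 (r : Fin d) : star (block f r (k, m)) * block f r (l, n)
      = star (rot f.1.1 0 k) * rot f.1.1 0 l *
          ((1 : Matrix (Fin d) (Fin d) ℂ) r m * (1 : Matrix (Fin d) (Fin d) ℂ) r n)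
        + star (rot f.1.1 0 k) * rot f.1.1 1 l * ((1 : Matrix (Fin d) (Fin d) ℂ) r m * kick f r n)
        + star (rot f.1.1 1 k) * rot f.1.1 0 l *
          ((1 : Matrix (Fin d) (Fin d) ℂ) r n * star (kick f r m))
        + star (rot f.1.1 1 k) * rot f.1.1 1 l * (star (kick f r m) * kick f r n) := by
    have hs : star ((1 : Matrix (Fin d) (Fin d) ℂ) r m) = (1 : Matrix (Fin d) (Fin d) ℂ) r m := by
      rw [Matrix.one_apply]; split_ifs <;> simp
    simp only [block, kicks, Matrix.of_apply, Fin.sum_univ_two, Matrix.cons_val_zero,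
      Matrix.cons_val_one, star_add, star_mul', hs]
    ring
  have h2 := sum_rot_col f.1.1 k l
  rw [Fin.sum_univ_two] at h2
  simp only [h1, Finset.sum_add_distrib, ← Finset.mul_sum, sum_kick_col]
  simp only [Matrix.one_apply, ite_mul, one_mul, zero_mul, Finset.sum_ite_eq', Finset.mem_univ,
    if_true, Prod.mk.injEq, ite_and] at h2 ⊢
  rcases eq_or_ne m n with rfl | hmn
  · simp only [if_true] at h2 ⊢
    rw [← h2]
    ring
  · simp [hmn]

/-- The Kraus operators of the channel. -/
def flagKraus (f : Flag d) : Matrix (Flag d × Fin d) (Fin 2 × Fin d) ℂ :=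
  Matrix.of fun g q => if g.1 = f then
    (((√(Fintype.card (Flag d) : ℝ))⁻¹ : ℝ) : ℂ) * block f g.2 q else 0

/-- The channel: its output contains the flag `f`, chosen at random. -/
def flagChannel (d : ℕ) : SuperOp (Fin 2 × Fin d) (Flag d × Fin d) := krausMap flagKraus

lemma star_norm_mul (d : ℕ) : star (((√(Fintype.card (Flag d) : ℝ))⁻¹ : ℝ) : ℂ) *
    (((√(Fintype.card (Flag d) : ℝ))⁻¹ : ℝ) : ℂ) = (Fintype.card (Flag d) : ℂ)⁻¹ := by
  rw [Complex.star_def, Complex.conj_ofReal, ← Complex.ofReal_mul, ← mul_inv,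
    Real.mul_self_sqrt (by positivity)]
  simp

lemma flagKraus_gram (f : Flag d) (k l : Fin 2) (m n : Fin d) :
    ((flagKraus f)ᴴ * flagKraus f) (k, m) (l, n) = (Fintype.card (Flag d) : ℂ)⁻¹ *
      ((1 : Matrix (Fin 2 × Fin d) (Fin 2 × Fin d) ℂ) (k, m) (l, n)
        + star (rot f.1.1 0 k) * rot f.1.1 1 l * kick f m n
        + star (rot f.1.1 1 k) * rot f.1.1 0 l * star (kick f n m)) := by
  rw [← block_gram, Matrix.mul_apply, Fintype.sum_prod_type, Finset.sum_eq_single f]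
  · rw [Finset.mul_sum, ← star_norm_mul]
    refine Finset.sum_congr rfl fun r _ => ?_
    simp only [Matrix.conjTranspose_apply, flagKraus, Matrix.of_apply, if_true, star_mul']
    ring
  · intro g _ hg
    simp [flagKraus, hg]
  · simp

lemma sum_I_pow : ∑ z : Fin 4, Complex.I ^ (z : ℕ) = 0 := by
  simp [Fin.sum_univ_four, Complex.I_pow_three]

/-- Orthogonality of characters of `ℤ/4`: the weight isolates the term in `U` from the constant term
and from the adjoint term. -/
lemma sum_neg_I_pow (A B C : ℂ) : ∑ z : Fin 4, (-Complex.I) ^ (z : ℕ) *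
    (A + Complex.I ^ (z : ℕ) * B + (-Complex.I) ^ (z : ℕ) * C) = 4 * B := by
  have h2 : (-Complex.I) ^ 2 = -1 := by rw [neg_sq, Complex.I_sq]
  have h3 : (-Complex.I) ^ 3 = Complex.I := by rw [pow_succ, h2]; ring
  simp only [Fin.sum_univ_four, Fin.val_zero, Fin.val_one, Fin.val_two, pow_zero, pow_one,
    show ((3 : Fin 4) : ℕ) = 3 from rfl, h2, h3, Complex.I_sq, Complex.I_pow_three]
  linear_combination (-2 * (B - C)) * Complex.I_sq

lemma isChannel_flagChannel (hd : 1 ≤ d) : IsChannel (flagChannel d) := by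
  refine isChannel_krausMap ?_
  have : NeZero d := ⟨by omega⟩
  have hN : (Fintype.card (Flag d) : ℂ) ≠ 0 := by simp; omega
  ext ⟨k, m⟩ ⟨l, n⟩
  rw [Matrix.sum_apply]
  simp only [flagKraus_gram, ← Finset.mul_sum, Finset.sum_add_distrib, Finset.sum_const,
    Finset.card_univ, nsmul_eq_mul]
  -- The phases sum to zero for each fixed rotation, transposition and sign; `h2` is the adjoint
  -- statement.
  have h1 (k l : Fin 2) (m n : Fin d) :
      ∑ f : Flag d, star (rot f.1.1 0 k) * rot f.1.1 1 l * kick f m n = 0 := by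
    rw [Fintype.sum_prod_type]
    refine Finset.sum_eq_zero fun x _ => ?_
    rw [Fintype.sum_prod_type_right]
    refine Finset.sum_eq_zero fun s _ => ?_
    simp only [kick, Matrix.of_apply]
    rw [← Finset.mul_sum, ← Finset.sum_mul, sum_I_pow, zero_mul, mul_zero]
  have h2 : ∑ f : Flag d, star (rot f.1.1 1 k) * rot f.1.1 0 l * star (kick f n m) = 0 := by
    have h := congrArg star (h1 l k n m)
    rw [star_sum, star_zero] at h
    refine (Finset.sum_congr rfl fun f _ => ?_).trans h
    rw [star_mul', star_mul', star_star, mul_comm (rot _ 0 l)]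
  rw [h1, h2, add_zero, add_zero, inv_mul_cancel_left₀ hN]

/-- The rank-one operators `|u⟩⟨v| ⊗ |m⟩⟨n|`, with `u`, `v` the rows of a rotation, lie in the span
of the operators `K f ᴴ * K f`. -/
lemma exists_sum_flagKraus (hd : 1 ≤ d) (x : Fin 3 × Fin d × Fin d) :
    ∃ c : Flag d → ℂ, ∑ f, c f • ((flagKraus f)ᴴ * flagKraus f)
      = Matrix.vecMulVec (fun q => star (rot x.1 0 q.1) * if q.2 = x.2.1 then 1 else 0)
          (fun q => rot x.1 1 q.1 * if q.2 = x.2.2 then 1 else 0) := by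
  have hN : (Fintype.card (Flag d) : ℂ) ≠ 0 := by simp; omega
  -- The cardinality cancels the normalization of the Kraus operators; the `8` is `4` from the phase
  -- sum times `2` from `signedSwap_sub`.
  refine ⟨fun f => if f.1 = x then (Fintype.card (Flag d) : ℂ) / 8 * ((-Complex.I) ^ (f.2.1 : ℕ) *
    if f.2.2 = 1 then -1 else 1) else 0, ?_⟩
  ext ⟨k, m⟩ ⟨l, n⟩
  rw [Matrix.sum_apply]
  simp only [Matrix.smul_apply, flagKraus_gram, smul_eq_mul, Matrix.vecMulVec_apply]
  have hx (y : Fin 3 × Fin d × Fin d) (hy : y ≠ x) : ∑ w : Fin 4 × Fin 2,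
      (if y = x then (Fintype.card (Flag d) : ℂ) / 8 * ((-Complex.I) ^ (w.1 : ℕ) *
        if w.2 = 1 then -1 else 1) else 0) * ((Fintype.card (Flag d) : ℂ)⁻¹ *
      ((1 : Matrix (Fin 2 × Fin d) (Fin 2 × Fin d) ℂ) (k, m) (l, n)
        + star (rot y.1 0 k) * rot y.1 1 l * kick (y, w) m n
        + star (rot y.1 1 k) * rot y.1 0 l * star (kick (y, w) n m))) = 0 := by
    simp [hy]
  have hs (s : Fin 2) : ∑ z : Fin 4, (Fintype.card (Flag d) : ℂ) / 8 * ((-Complex.I) ^ (z : ℕ) *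
        if s = 1 then -1 else 1) * ((Fintype.card (Flag d) : ℂ)⁻¹ *
      ((1 : Matrix (Fin 2 × Fin d) (Fin 2 × Fin d) ℂ) (k, m) (l, n)
        + star (rot x.1 0 k) * rot x.1 1 l * kick (x, z, s) m n
        + star (rot x.1 1 k) * rot x.1 0 l * star (kick (x, z, s) n m)))
      = (if s = 1 then -1 else 1) / 2 * (star (rot x.1 0 k) * rot x.1 1 l * signedSwap x s m n) := by
    have := sum_neg_I_pow ((1 : Matrix (Fin 2 × Fin d) (Fin 2 × Fin d) ℂ) (k, m) (l, n))
      (star (rot x.1 0 k) * rot x.1 1 l * signedSwap x s m n)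
      (star (rot x.1 1 k) * rot x.1 0 l * signedSwap x s n m)
    rw [show (if s = 1 then (-1 : ℂ) else 1) / 2 * (star (rot x.1 0 k) * rot x.1 1 l *
      signedSwap x s m n) = (if s = 1 then (-1 : ℂ) else 1) / 8 * (4 * (star (rot x.1 0 k) *
      rot x.1 1 l * signedSwap x s m n)) by ring, ← this, Finset.mul_sum]
    refine Finset.sum_congr rfl fun z _ => ?_
    rw [star_kick, kick, Matrix.of_apply]
    field_simp
  rw [Fintype.sum_prod_type, Finset.sum_eq_single x (fun y _ => hx y) (by simp),
    Fintype.sum_prod_type_right]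
  simp only [if_true, hs, Fin.sum_univ_two]
  have := signedSwap_sub x m n
  simp only [zero_ne_one, if_false]
  linear_combination (star (rot x.1 0 k) * rot x.1 1 l / 2) * this

end Channel

/-! ### Zero-error behaviour of the flag channel, alone and on half of a Bell pair -/

section Capacities

variable {d : ℕ}

/-- The first rows of the three rotations are pairwise non-proportional, so at most one of them
annihilates `u`; likewise at most one second row annihilates `v`. One of the three choices survives
both exclusions. -/
lemma exists_rot (u v : Fin 2 → ℂ) (hu : u ≠ 0) (hv : v ≠ 0) :
    ∃ x, ∑ k, u k * star (rot x 0 k) ≠ 0 ∧ ∑ k, rot x 1 k * v k ≠ 0 := by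
  by_contra! h
  have h0 := h 0
  have h1 := h 1
  have h2 := h 2
  simp only [rot, Fin.sum_univ_two, Matrix.cons_val_zero, Matrix.cons_val_one, Matrix.cons_val,
    Matrix.of_apply, Matrix.cons_val', Complex.star_def, map_div₀, map_ofNat,
    map_one, map_zero, mul_one, mul_zero, one_mul, zero_mul, add_zero, zero_add] at h0 h1 h2
  have hu' : u 0 = 0 → u 1 = 0 → False := fun h h' => hu (by ext i; fin_cases i <;> simpa)
  have hv' : v 0 = 0 → v 1 = 0 → False := fun h h' => hv (by ext i; fin_cases i <;> simpa)
  by_cases hu0 : u 0 = 0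
  · have hu1 : u 1 ≠ 0 := hu' hu0
    have hv0 : v 0 = 0 := by simpa using h1 hu1
    exact hv' hv0 (by simpa [hv0] using h2 (by simpa [hu0] using hu1))
  · have hv1 := h0 hu0
    by_cases hu1 : u 1 = 0
    · exact hv' (by simpa [hv1] using h2 (by simpa [hu1] using hu0)) hv1
    · exact hv' (by simpa using h1 hu1) hv1

lemma zeroErrorC_flagChannel (hd : 1 ≤ d) : zeroErrorC (flagChannel d) = 0 := by
  refine rate_eq_zero (cliqueNumber_tensorPow_le_one (exists_sum_flagKraus hd) ?_)
  intro ψ φ hψ hφ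
  -- The matrix unit `|m⟩⟨n|` selects one slice of each vector, which reduces the claim to two
  -- nonzero qubit vectors.
  obtain ⟨⟨k, m⟩, hm⟩ := Function.ne_iff.mp hψ
  obtain ⟨⟨l, n⟩, hn⟩ := Function.ne_iff.mp hφ
  obtain ⟨x, hx, hx'⟩ := exists_rot (fun k => ψ (k, m)) (fun l => φ (l, n))
    (Function.ne_iff.mpr ⟨k, hm⟩) (Function.ne_iff.mpr ⟨l, hn⟩)
  refine ⟨(x, m, n), ?_, ?_⟩
  · simpa [Fintype.sum_prod_type] using hx
  · simpa [Fintype.sum_prod_type] using hx'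

/-- The rows of the rotation are orthonormal, so a control prepared in the conjugate of row `i`
triggers exactly the operator with index `i`. -/
lemma sum_star_rot_mul_block (f : Flag d) (i : Fin 2) (m n : Fin d) :
    ∑ k, star (rot f.1.1 i k) * block f m (k, n) = kicks f i m n := by
  have h (j : Fin 2) : ∑ k, star (rot f.1.1 i k) * (rot f.1.1 j k * kicks f j m n)
      = (1 : Matrix (Fin 2) (Fin 2) ℂ) j i * kicks f j m n := by
    rw [← sum_rot_row, Finset.sum_mul]
    exact Finset.sum_congr rfl fun k _ => by ring
  simp only [block, Matrix.of_apply, Finset.mul_sum]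
  rw [Finset.sum_comm, Finset.sum_congr rfl fun j _ => h j]
  simp [Matrix.one_apply]

lemma flagChannel_apply (X : Matrix (Fin 2 × Fin d) (Fin 2 × Fin d) ℂ) (f : Flag d)
    (m n : Fin d) : flagChannel d X (f, m) (f, n)
      = (Fintype.card (Flag d) : ℂ)⁻¹ * (block f * X * (block f)ᴴ) m n := by
  rw [flagChannel, krausMap_apply, Matrix.sum_apply, Finset.sum_eq_single f]
  · simp only [Matrix.mul_apply, Matrix.conjTranspose_apply, flagKraus, Matrix.of_apply, if_true,
      star_mul', ← star_norm_mul, Finset.mul_sum, Finset.sum_mul]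
    exact Finset.sum_congr rfl fun p _ => Finset.sum_congr rfl fun q _ => by ring
  · intro g _ hg
    simp [Matrix.mul_apply, flagKraus, hg.symm]
  · simp

/-- The message after the measurement of the qubit that is entangled with the input. -/
lemma measure_flagChannel (ρ : Matrix (Fin d) (Fin d) ℂ) (f : Flag d) (i : Fin 2) (m n : Fin d) :
    ∑ k, ∑ l, star (rot f.1.1 i k) * rot f.1.1 i l *
      flagChannel d (Matrix.of fun p q => bell (k, p.1) (l, q.1) * ρ p.2 q.2) (f, m) (f, n)
      = (Fintype.card (Flag d) : ℂ)⁻¹ / 2 * (kicks f i * ρ * (kicks f i)ᴴ) m n := by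
  have h (k l : Fin 2) :
      flagChannel d (Matrix.of fun p q => bell (k, p.1) (l, q.1) * ρ p.2 q.2) (f, m) (f, n)
        = (Fintype.card (Flag d) : ℂ)⁻¹ / 2 *
          ∑ q, ∑ p, block f m (k, p) * ρ p q * star (block f n (l, q)) := by
    rw [flagChannel_apply]
    simp only [Matrix.mul_apply, Fintype.sum_prod_type, Matrix.conjTranspose_apply,
      Matrix.of_apply, bell, ite_and, ite_mul, mul_ite, zero_mul, mul_zero]
    simp only [Finset.sum_ite_irrel, Finset.sum_const_zero, Finset.sum_ite_eq, Finset.mem_univ,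
      if_true, ite_mul, zero_mul, Finset.sum_mul]
    simp only [Finset.mul_sum]
    exact Finset.sum_congr rfl fun q _ => Finset.sum_congr rfl fun p _ => by ring
  have hk (p : Fin d) : kicks f i m p = star (rot f.1.1 i 0) * block f m (0, p)
      + star (rot f.1.1 i 1) * block f m (1, p) := by
    rw [← sum_star_rot_mul_block, Fin.sum_univ_two]
  have hk' (q : Fin d) : star (kicks f i n q) = rot f.1.1 i 0 * star (block f n (0, q))
      + rot f.1.1 i 1 * star (block f n (1, q)) := by
    rw [← sum_star_rot_mul_block, Fin.sum_univ_two]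
    simp
  simp only [h, Matrix.mul_apply, Matrix.conjTranspose_apply, hk, hk', Fin.sum_univ_two,
    Finset.mul_sum, Finset.sum_mul, ← Finset.sum_add_distrib]
  exact Finset.sum_congr rfl fun q _ => Finset.sum_congr rfl fun p _ => by ring

lemma card_flag_ne_zero (hd : 1 ≤ d) : (Fintype.card (Flag d) : ℂ) ≠ 0 := by
  simp
  omega

lemma kicks_conj (f : Flag d) (i : Fin 2) (ρ : Matrix (Fin d) (Fin d) ℂ) :
    (kicks f i)ᴴ * (kicks f i * ρ * (kicks f i)ᴴ) * kicks f i = ρ := by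
  rw [← Matrix.mul_assoc, ← Matrix.mul_assoc, kicks_unitary, Matrix.one_mul, Matrix.mul_assoc,
    kicks_unitary, Matrix.mul_one]

/-! ### Assistance by a qubit -/

/-- Kraus operators of the decoder: read the flag, measure the qubit and undo the kick. -/
def decoderKraus (x : Flag d × Fin 2) : Matrix (Fin d) (Fin 2 × Flag d × Fin d) ℂ :=
  Matrix.of fun n q => if q.2.1 = x.1 then
    star (rot x.1.1.1 x.2 q.1) * star (kicks x.1 x.2 q.2.2 n) else 0

lemma isChannel_decoder : IsChannel (krausMap (decoderKraus (d := d))) := by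
  refine isChannel_krausMap ?_
  ext ⟨k, f, m⟩ ⟨l, g, n⟩
  have h1 (i : Fin 2) : ∑ r, kicks f i m r * star (kicks f i n r)
      = (1 : Matrix (Fin d) (Fin d) ℂ) m n := by
    rw [← mul_eq_one_comm.mp (kicks_unitary f i), Matrix.mul_apply]
    rfl
  rw [Matrix.sum_apply, Fintype.sum_prod_type, Finset.sum_eq_single f]
  · by_cases hg : g = f
    · subst hg
      have h2 (i : Fin 2) : ((decoderKraus (g, i))ᴴ * decoderKraus (g, i)) (k, g, m) (l, g, n)
          = star (rot g.1.1 i l) * rot g.1.1 i k * (1 : Matrix (Fin d) (Fin d) ℂ) m n := by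
        rw [← h1 i, Matrix.mul_apply, Finset.mul_sum]
        refine Finset.sum_congr rfl fun r _ => ?_
        simp only [Matrix.conjTranspose_apply, decoderKraus, Matrix.of_apply, if_true, star_mul',
          star_star]
        ring
      simp only [h2]
      rw [← Finset.sum_mul, sum_rot_col]
      simp only [Matrix.one_apply, Prod.mk.injEq, true_and, ite_and, @eq_comm _ l k]
      split_ifs <;> simp
    · simp [Matrix.mul_apply, decoderKraus, hg, Ne.symm hg]
  · intro x _ hx
    simp [Matrix.mul_apply, decoderKraus, hx.symm]
  · simp

/-- Each pair of flag and outcome, once its unitary is undone, contributes the same multiple of `ρ`,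
and the multiples add up to one. The hypothesis involves only the blocks of `Y` diagonal in the
flag, so it serves both the noiseless qubit and the ebit. -/
lemma decoder_apply (hd : 1 ≤ d) {ρ : Matrix (Fin d) (Fin d) ℂ}
    {Y : Matrix (Fin 2 × Flag d × Fin d) (Fin 2 × Flag d × Fin d) ℂ}
    (hY : ∀ k l f m n, Y (k, f, m) (l, f, n)
      = flagChannel d (Matrix.of fun p q => bell (k, p.1) (l, q.1) * ρ p.2 q.2) (f, m) (f, n)) :
    krausMap decoderKraus Y = ρ := by
  have key (x : Flag d × Fin 2) : decoderKraus x * Y * (decoderKraus x)ᴴ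
      = ((Fintype.card (Flag d) : ℂ)⁻¹ / 2) • ρ := by
    obtain ⟨f, i⟩ := x
    rw [← kicks_conj f i ρ, ← Matrix.smul_mul, ← Matrix.mul_smul]
    ext u v
    have hm (m n : Fin d) : (((Fintype.card (Flag d) : ℂ)⁻¹ / 2) • (kicks f i * ρ * (kicks f i)ᴴ))
        m n = ∑ k, ∑ l, star (rot f.1.1 i k) * rot f.1.1 i l * Y (k, f, m) (l, f, n) := by
      rw [Matrix.smul_apply, smul_eq_mul, ← measure_flagChannel]
      simp only [hY]
    have hsum (g : Fin 2 × Flag d × Fin d → ℂ) :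
        ∑ q, (if q.2.1 = f then g q else 0) = ∑ m, ∑ k, g (k, f, m) := by
      rw [Fintype.sum_prod_type, Finset.sum_comm' (t' := Finset.univ) (s' := fun _ => Finset.univ)
        (by simp), Fintype.sum_prod_type, Finset.sum_eq_single f]
      · simp
      · intro g _ hg
        simp [hg]
      · simp
    rw [Matrix.mul_apply, Matrix.mul_apply]
    simp only [Matrix.mul_apply, hm, Matrix.conjTranspose_apply]
    simp only [decoderKraus, Matrix.of_apply, apply_ite star, star_zero, ite_mul, mul_ite,
      zero_mul, mul_zero, hsum, star_mul', star_star]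
    simp only [Fin.sum_univ_two, Finset.sum_mul, ← Finset.sum_add_distrib]
    exact Finset.sum_congr rfl fun q _ => Finset.sum_congr rfl fun p _ => by ring
  have hN := card_flag_ne_zero hd
  rw [krausMap_apply, Finset.sum_congr rfl fun x _ => key x, Finset.sum_const, Finset.card_univ,
    Fintype.card_prod, Fintype.card_fin, ← Nat.cast_smul_eq_nsmul ℂ, smul_smul]
  push_cast
  rw [show (Fintype.card (Flag d) : ℂ) * 2 * ((Fintype.card (Flag d) : ℂ)⁻¹ / 2) = 1 by
    field_simp, one_smul]

lemma le_quantumCliqueDim_tensorMap (hd : 1 ≤ d) :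
    (d : ℕ∞) ≤ quantumCliqueDim (tensorMap idQubit (flagChannel d)) := by
  have h2 : (((√2 : ℝ)⁻¹ : ℝ) : ℂ) * (((√2 : ℝ)⁻¹ : ℝ) : ℂ) = 1 / 2 := by
    rw [← Complex.ofReal_mul, ← mul_inv, Real.mul_self_sqrt zero_le_two]
    simp
  -- The code space is the Bell vector tensored with the message: one qubit goes through the
  -- noiseless channel, the other becomes the control.
  refine le_iSup₂_of_le d ⟨Matrix.of fun p n => if p.1 = p.2.1 then
    (if p.2.2 = n then (((√2 : ℝ)⁻¹ : ℝ) : ℂ) else 0) else 0, krausMap decoderKraus, ?_,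
    isChannel_decoder, fun ψ => decoder_apply hd fun k l f m n => ?_⟩ le_rfl
  · ext m n
    simp only [Matrix.mul_apply, Fintype.sum_prod_type, Matrix.conjTranspose_apply,
      Matrix.of_apply, Matrix.one_apply, apply_ite star, star_zero, Complex.star_def,
      Complex.conj_ofReal, ite_mul, mul_ite, zero_mul, mul_zero, h2]
    by_cases hmn : m = n <;> simp [hmn, Ne.symm]
  · refine congrArg (fun Z => flagChannel d Z (f, m) (f, n)) ?_
    ext p q
    simp only [Matrix.of_apply, Matrix.mul_apply, Matrix.conjTranspose_apply, bell]
    by_cases hp : k = p.1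
    · by_cases hq : l = q.1
      · simp only [hp, hq, if_true, apply_ite star, star_zero, Complex.star_def,
          Complex.conj_ofReal, ite_mul, mul_ite, zero_mul, mul_zero, Finset.sum_ite_eq,
          Finset.mem_univ, and_self, ← h2]
        ring
      · simp [hp, hq]
    · simp [hp]

lemma le_quantumCliqueDimEbit (hd : 1 ≤ d) :
    (d : ℕ∞) ≤ quantumCliqueDimEbit (flagChannel d) :=
  le_iSup₂_of_le d ⟨LinearMap.id, krausMap decoderKraus, ⟨isCP_id, fun _ => rfl⟩,
    isChannel_decoder, fun _ => decoder_apply hd fun _ _ _ _ _ => rfl⟩ le_rfl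

/-! ### Assistance by two-way classical communication -/

lemma isState_bell : IsState bell := by
  constructor
  · have : bell = (1 / 2 : ℂ) • Matrix.vecMulVec (fun p : Fin 2 × Fin 2 => if p.1 = p.2 then 1 else 0)
        (star fun p : Fin 2 × Fin 2 => if p.1 = p.2 then (1 : ℂ) else 0) := by
      ext p q
      by_cases hp : p.1 = p.2 <;> by_cases hq : q.1 = q.2 <;>
        simp [bell, Matrix.vecMulVec_apply, hp, hq]
    rw [this]
    exact (Matrix.posSemidef_vecMulVec_self_star _).smul one_half_pos.le
  · simp [bell, Matrix.trace, Fintype.sum_prod_type]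

/-- Bob reads the flag `f`. -/
def readFlag (f : Flag d) : SuperOp (Unit × Flag d × Fin d) (Fin d) :=
  krausMap fun _ : Unit => Matrix.of fun m s => if s.2 = (f, m) then 1 else 0

lemma readFlag_apply (f : Flag d) (Y) (m n : Fin d) :
    readFlag f Y m n = Y ((), f, m) ((), f, n) := by
  have hs (p : Unit × Flag d × Fin d) (m) : p.2 = (f, m) ↔ p = ((), f, m) := by
    simp [Prod.ext_iff]
  simp [readFlag, krausMap_apply, Matrix.mul_apply, hs]

lemma isInstrument_readFlag : IsInstrument (readFlag (d := d)) := by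
  refine isInstrument_krausMap ?_
  ext ⟨_, f, m⟩ ⟨_, g, n⟩
  simp only [Matrix.sum_apply, Matrix.mul_apply, Matrix.conjTranspose_apply, Matrix.of_apply,
    apply_ite star, star_one, star_zero, Prod.mk.injEq, ite_and, mul_ite, mul_one, mul_zero,
    Finset.univ_unique, Finset.sum_singleton, Finset.sum_ite_irrel, Finset.sum_const_zero,
    Finset.sum_ite_eq, Finset.mem_univ, if_true, Matrix.one_apply, true_and]

/-- Alice measures her qubit. -/
def measureQubit (x : Fin 3) (i : Fin 2) : SuperOp (Fin 2) Unit :=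
  krausMap fun _ : Unit => Matrix.of fun _ k => star (rot x i k)

lemma measureQubit_apply (x : Fin 3) (i : Fin 2) (Y) (u v : Unit) :
    measureQubit x i Y u v = ∑ k, ∑ l, star (rot x i k) * rot x i l * Y k l := by
  simp [measureQubit, krausMap_apply, Matrix.mul_apply]
  ring

lemma isInstrument_measureQubit (x : Fin 3) : IsInstrument (measureQubit x) := by
  refine isInstrument_krausMap ?_
  ext k l
  have := sum_rot_col x l k
  simp only [Matrix.sum_apply, Matrix.mul_apply, Matrix.conjTranspose_apply, Matrix.of_apply,
    star_star, Finset.univ_unique, Finset.sum_singleton]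
  simp only [mul_comm (rot _ _ _), this, Matrix.one_apply, eq_comm]

/-- Alice exchanges the message and her qubit. -/
def exchange (d : ℕ) : Unit × Fin 2 × Fin d ≃ Fin d × Fin 2 where
  toFun x := (x.2.2, x.2.1)
  invFun y := ((), y.2, y.1)
  left_inv _ := rfl
  right_inv _ := rfl

lemma trace_bobState {M R S : Type} [Fintype M] [Fintype R] [Fintype S]
    (X : Matrix (M × R × S) (M × R × S) ℂ) : (bobState X).trace = X.trace := by
  simp only [bobState, Matrix.trace, Matrix.diag_apply, Matrix.of_apply, Fintype.sum_prod_type]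
  rw [Finset.sum_comm]
  exact Finset.sum_congr rfl fun m _ => Finset.sum_comm

lemma tensorMap_id_left {a c e : Type} (Φ : SuperOp c e) (X : Matrix (a × c) (a × c) ℂ)
    (p q : a × e) : tensorMap LinearMap.id Φ X p q
      = Φ (Matrix.of fun k l => X (p.1, k) (q.1, l)) p.2 q.2 := rfl

lemma tensorMap_id_right {a b c : Type} (Φ : SuperOp a b) (X : Matrix (a × c) (a × c) ℂ)
    (p q : b × c) : tensorMap Φ LinearMap.id X p q
      = Φ (Matrix.of fun i j => X (i, p.2) (j, q.2)) p.1 q.1 := rfl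

/-- The joint state after Alice has sent the message and one half of a maximally entangled pair
through the channel. -/
def sentState (ρ : Matrix (Fin d) (Fin d) ℂ) :
    Matrix (Unit × Fin 2 × Unit × Flag d × Fin d) (Unit × Fin 2 × Unit × Flag d × Fin d) ℂ :=
  (tensorMap (tensorMap (LinearMap.id : SuperOp Unit Unit) (flagChannel d) ∘ₗ relabel (exchange d))
      (LinearMap.id : SuperOp (Fin 2 × Unit) (Fin 2 × Unit))
    ((ρ ⊗ₖ (bell ⊗ₖ (1 : Matrix Unit Unit ℂ))).submatrix
      (fun x : (Fin d × Fin 2) × (Fin 2 × Unit) =>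
        (x.1.1, (Equiv.refl (Fin 2 × Fin 2)).symm (x.2.1, x.1.2), x.2.2))
      (fun x : (Fin d × Fin 2) × (Fin 2 × Unit) =>
        (x.1.1, (Equiv.refl (Fin 2 × Fin 2)).symm (x.2.1, x.1.2), x.2.2)))).submatrix
    (fun y : Unit × Fin 2 × Unit × Flag d × Fin d => ((y.1, y.2.2.2), (y.2.1, y.2.2.1)))
    (fun y : Unit × Fin 2 × Unit × Flag d × Fin d => ((y.1, y.2.2.2), (y.2.1, y.2.2.1)))

/-- The joint state after Bob has read the flag and Alice has measured her qubit. -/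
def feedbackBranch (t : (Unit × Flag d) × Fin 2) (ρ : Matrix (Fin d) (Fin d) ℂ) :
    Matrix (Unit × Unit × Fin d) (Unit × Unit × Fin d) ℂ :=
  tensorMap LinearMap.id (tensorMap (measureQubit t.1.2.1.1 t.2) LinearMap.id)
    (tensorMap LinearMap.id (tensorMap LinearMap.id (readFlag t.1.2)) (sentState ρ))

/-- Alice sends the message and one half of a maximally entangled pair through the channel, Bob
reads and announces the flag, Alice measures the other half and announces the outcome. -/
def feedbackStage (d : ℕ) : Stage d where
  T := (Unit × Flag d) × Fin 2
  M := Unit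
  R := Unit
  S := Fin d
  branch := feedbackBranch

/-- The Bell pair is the initial auxiliary system. One half enters the channel with the message; the
retained half never meets the message, so measuring it for the announcement is allowed. -/
lemma reachable_feedbackStage : Reachable (flagChannel d) 1 (feedbackStage d) :=
  (((Reachable.init (E := flagChannel d) (N := d) bell isState_bell).use (M' := Unit)
    (R' := Fin 2) (Q := Fin 2) (Equiv.refl _) (fun _ => relabel (exchange d))
    fun _ => isChannel_relabel _).bob (fun _ => readFlag) fun _ => isInstrument_readFlag).alice
    (fun t => measureQubit t.2.1.1) fun _ => isInstrument_measureQubit _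

/-- The weight does not depend on the transcript or on `ρ`, and the conjugating unitary is known
from the transcript; this gives both independence and recovery. -/
lemma bobState_feedbackBranch (t : (Unit × Flag d) × Fin 2) (ρ : Matrix (Fin d) (Fin d) ℂ) :
    bobState (feedbackBranch t ρ)
      = ((Fintype.card (Flag d) : ℂ)⁻¹ / 2) • (kicks t.1.2 t.2 * ρ * (kicks t.1.2 t.2)ᴴ) := by
  obtain ⟨⟨_, f⟩, i⟩ := t
  have hs (k l : Fin 2) (m n : Fin d) : sentState ρ ((), k, (), f, m) ((), l, (), f, n)
      = flagChannel d (Matrix.of fun p q => bell (k, p.1) (l, q.1) * ρ p.2 q.2) (f, m) (f, n) := by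
    refine congrArg (fun Z => flagChannel d Z (f, m) (f, n)) ?_
    ext p q
    change ρ p.2 q.2 * (bell (k, p.1) (l, q.1) * 1) = _
    rw [mul_one, mul_comm, Matrix.of_apply]
  ext m n
  rw [Matrix.smul_apply, smul_eq_mul, ← measure_flagChannel]
  simp only [bobState, feedbackBranch, tensorMap_id_left, tensorMap_id_right, Matrix.of_apply,
    Fintype.sum_unique, measureQubit_apply, readFlag_apply]
  exact Finset.sum_congr rfl fun k _ => Finset.sum_congr rfl fun l _ =>
    congrArg (star (rot f.1.1 i k) * rot f.1.1 i l * ·) (hs k l m n)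

lemma le_quantumCliqueDimTwoWay (hd : 1 ≤ d) :
    (d : ℕ∞) ≤ quantumCliqueDimTwoWay (flagChannel d) 1 := by
  have hN := card_flag_ne_zero hd
  have htr (t : (Unit × Flag d) × Fin 2) {ρ : Matrix (Fin d) (Fin d) ℂ} (hρ : IsState ρ) :
      (feedbackBranch t ρ).trace = (Fintype.card (Flag d) : ℂ)⁻¹ / 2 := by
    rw [← trace_bobState, bobState_feedbackBranch, Matrix.trace_smul, Matrix.trace_mul_comm,
      ← Matrix.mul_assoc, kicks_unitary, Matrix.one_mul, hρ.2, smul_eq_mul, mul_one]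
  refine le_iSup₂_of_le d ⟨feedbackStage d, fun t => krausMap fun _ : Unit => (kicks t.1.2 t.2)ᴴ,
    reachable_feedbackStage, fun t => isChannel_krausMap ?_,
    fun t ρ ρ' hρ hρ' => (htr t hρ).trans (htr t hρ').symm, fun ψ => ?_⟩ le_rfl
  · rw [Fintype.sum_unique]
    exact (congrArg (· * _) (Matrix.conjTranspose_conjTranspose _)).trans
      (mul_eq_one_comm.mp (kicks_unitary _ _))
  · have key (t : (Unit × Flag d) × Fin 2) :
        krausMap (fun _ : Unit => (kicks t.1.2 t.2)ᴴ)
          (bobState (feedbackBranch t (pureState ψ)))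
        = ((Fintype.card (Flag d) : ℂ)⁻¹ / 2) • pureState ψ := by
      rw [bobState_feedbackBranch, map_smul, krausMap_apply, Fintype.sum_unique,
        Matrix.conjTranspose_conjTranspose, kicks_conj]
    change ∑ t : (Unit × Flag d) × Fin 2, krausMap (fun _ : Unit => (kicks t.1.2 t.2)ᴴ)
      (bobState (feedbackBranch t (pureState ψ))) = _
    rw [Finset.sum_congr rfl fun t _ => key t, Finset.sum_const, Finset.card_univ,
      ← Nat.cast_smul_eq_nsmul ℂ, smul_smul, Fintype.card_prod, Fintype.card_prod (α := Unit),
      Fintype.card_unit, Fintype.card_fin, one_mul, Nat.cast_mul, Nat.cast_two,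
      show (Fintype.card (Flag d) : ℂ) * 2 * ((Fintype.card (Flag d) : ℂ)⁻¹ / 2) = 1 by
        field_simp, one_smul]

end Capacities

end
end ZeroError

/-! ### The capacities assembled -/

theorem corollary3 (d : ℕ) (hd : 1 ≤ d) :
    ∃ (b : Type) (_ : Fintype b) (_ : DecidableEq b) (E : ZeroError.SuperOp (Fin 2 × Fin d) b),
      ZeroError.IsChannel E ∧
      ZeroError.zeroErrorC E = 0 ∧
      (((Real.logb 2 d : ℝ) : EReal) ≤
          ZeroError.zeroErrorC (ZeroError.tensorMap ZeroError.idQubit E) ∧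
        ZeroError.zeroErrorC ZeroError.idQubit + ZeroError.zeroErrorC E = 1 ∧
        (2 < d → ZeroError.zeroErrorC ZeroError.idQubit + ZeroError.zeroErrorC E <
          ZeroError.zeroErrorC (ZeroError.tensorMap ZeroError.idQubit E))) ∧
      (((Real.logb 2 d : ℝ) : EReal) ≤
          ZeroError.zeroErrorQ (ZeroError.tensorMap ZeroError.idQubit E) ∧
        ZeroError.zeroErrorQ ZeroError.idQubit + ZeroError.zeroErrorQ E = 1 ∧
        (2 < d → ZeroError.zeroErrorQ ZeroError.idQubit + ZeroError.zeroErrorQ E <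
          ZeroError.zeroErrorQ (ZeroError.tensorMap ZeroError.idQubit E))) ∧
      (((Real.logb 2 d : ℝ) : EReal) ≤ ZeroError.zeroErrorQTwoWay E ∧
        ZeroError.zeroErrorQTwoWay E ≤ ZeroError.zeroErrorCTwoWay E) ∧
      (((Real.logb 2 d : ℝ) : EReal) ≤ ZeroError.zeroErrorQEbit E ∧
        ZeroError.zeroErrorQEbit E ≤ ZeroError.zeroErrorCEbit E) := by
  open ZeroError in
  have hE := isChannel_flagChannel hd
  have hC := zeroErrorC_flagChannel hd
  have hQ : zeroErrorQ (flagChannel d) = 0 :=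
    le_antisymm ((zeroErrorQ_le_zeroErrorC _).trans_eq hC)
      ((log2_nonneg _).trans (log2_le_zeroErrorQ _))
  have hQT : ((Real.logb 2 d : ℝ) : EReal) ≤ zeroErrorQ (tensorMap idQubit (flagChannel d)) :=
    (log2_mono (le_quantumCliqueDim_tensorMap hd)).trans (log2_le_zeroErrorQ _)
  have hCT := hQT.trans (zeroErrorQ_le_zeroErrorC _)
  -- Strict superadditivity holds because the sum of the separate capacities is only `1`.
  have hlog (h : 2 < d) : (1 : EReal) < ((Real.logb 2 d : ℝ) : EReal) := by
    have h2 : (2 : ℝ) < d := by exact_mod_cast h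
    have : (1 : ℝ) < Real.logb 2 d := by
      rw [Real.lt_logb_iff_rpow_lt one_lt_two (by linarith), Real.rpow_one]
      exact h2
    exact_mod_cast this
  have hC1 : zeroErrorC idQubit + zeroErrorC (flagChannel d) = 1 := by
    rw [hC, zeroErrorC_idQubit, add_zero]
  have hQ1 : zeroErrorQ idQubit + zeroErrorQ (flagChannel d) = 1 := by
    rw [hQ, zeroErrorQ_idQubit, add_zero]
  exact ⟨Flag d × Fin d, inferInstance, inferInstance, flagChannel d, hE, hC,
    ⟨hCT, hC1, fun h => hC1.trans_lt ((hlog h).trans_le hCT)⟩,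
    ⟨hQT, hQ1, fun h => hQ1.trans_lt ((hlog h).trans_le hQT)⟩,
    ⟨(log2_mono (le_quantumCliqueDimTwoWay hd)).trans
      (log2_le_rate (quantumCliqueDimTwoWay (flagChannel d))),
      zeroErrorQTwoWay_le_zeroErrorCTwoWay hE.1⟩,
    (log2_mono (le_quantumCliqueDimEbit hd)).trans (log2_le_zeroErrorQEbit _),
    zeroErrorQEbit_le_zeroErrorCEbit _⟩
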